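/- **Definitions.** All graphs are finite, simple and connected. A *distribution* on a graph $G$ is a function $D:V(G)\to\{0,1,2,\dots\}$ (where $D(v)$ is the number of pebbles on $v$), and its *size* is $\sum_v D(v)$. A *pebbling step* removes two pebbles from a vertex $u$ and places one pebble on a neighbour of $u$. $D$ is *solvable* if for every vertex $r$ some finite (possibly empty) sequence of pebbling steps starting from $D$ puts at least one pebble on $r$. A *graph sequence* is a sequence $\mathcal G=(G_1,G_2,\dots)$ of connected graphs whose numbers of vertices $n=n(m)=|V(G_m)|$ tend to infinity (in particular, $G_n$ may have exactly $n$ vertices for each $n$). Let $P_{\mathcal G}(m,t)$ be the probability that a distribution chosen uniformly at random from all distributions of size $t$ on $G_m$ is solvable. A function $g$ of the index $m$, with $g(m)>0$ for all large $m$, is a *threshold* for $\mathcal G$, written $g\in th(\mathcal G)$, if for all functions $t=t(m)$ with non-negative integer values, as $m\to\infty$: $P_{\mathcal G}(m,t)\to1$ whenever $g/t\to0$, and $P_{\mathcal G}(m,t)\to0$ whenever $t/g\to0$. We say that $th(\mathcal G)$ *exists* if it is non-empty. The symbols $O$, $\Omega$, $\Theta$, $o$ denote sets of eventually positive functions of the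 index $m$, as $m\to\infty$, and in them $n$ stands for $|V(G_m)|$. The *connectivity* of $G$ is the largest $k$ such that $G$ has more than $k$ vertices and stays connected after the deletion of any fewer than $k$ vertices. Let $\mathcal P,\mathcal C,\mathcal S,\mathcal W$ be the sequences of paths, cycles, stars and wheels in which the $n$-th graph has $n$ vertices, and let $\mathcal Q=(Q^1,Q^2,\dots)$, where $Q^m$ is the $m$-dimensional cube, with $n=2^m$ vertices. **Theorem.** (a) For every graph sequence $\mathcal G$, if $th(\mathcal G)$ exists then, for every $\varepsilon>0$, $th(\mathcal G)\subseteq\Omega(n^{1/2})\cap o(n^{1+\varepsilon})$. (b) Let $\mathcal G$ be a graph sequence for which $th(\mathcal G)$ exists. If there is a constant $d$ with $\mathrm{diam}(G_m)\le d$ for all $m$, then $th(\mathcal G)\subseteq O(n)$. (c) Let $\mathcal G$ be a graph sequence for which $th(\mathcal G)$ exists, and let $d(m)$ and $k(m)$ be the diameter and the connectivity of $G_m$. If $k(m)\ge 2^{2d(m)+3}$ for all sufficiently large $m$, then $th(\mathcal G)\subseteq O(n)$. (d) If $th(\mathcal Q)$ exists then $th(\mathcal Q)\subseteq\Omega(n^{1/2})\cap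 O(n)$. (e) If $th(\mathcal C)$ exists then, for every $\varepsilon>0$, $th(\mathcal C)\subseteq\Omega(n)\cap o(n^{1+\varepsilon})$. (f) If $th(\mathcal P)$ exists then, for every $\varepsilon>0$, $th(\mathcal P)\subseteq\Omega(n)\cap o(n^{1+\varepsilon})$. (g) $th(\mathcal S)=\Theta(n^{1/2})$. (h) $th(\mathcal W)=\Theta(n^{1/2})$. -/

import Mathlib

open Filter Asymptotics Topology

namespace Pebbling

/-- The size of a distribution `D` of pebbles: the total number of pebbles. -/
def size {V : Type*} [Fintype V] (D : V → ℕ) : ℕ := ∑ v, D v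

/-- `D'` arises from `D` by one pebbling step `[u, v]`: two pebbles are removed from a vertex `u`
and one pebble is placed at a vertex `v` adjacent to `u`. -/
def Step {V : Type*} (G : SimpleGraph V) (D D' : V → ℕ) : Prop :=
  ∃ u v, G.Adj u v ∧ D u = D' u + 2 ∧ D' v = D v + 1 ∧ ∀ w, w ≠ u → w ≠ v → D' w = D w

/-- `D` is `r`-solvable: some finite (possibly empty) sequence of pebbling steps leads from `D` to
a distribution with a pebble on `r`. -/
def SolvableAt {V : Type*} (G : SimpleGraph V) (r : V) (D : V → ℕ) : Prop :=
  ∃ D', Relation.ReflTransGen (Step G) D D' ∧ 1 ≤ D' r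

/-- `D` is solvable: it is `r`-solvable for every root vertex `r`. -/
def Solvable {V : Type*} (G : SimpleGraph V) (D : V → ℕ) : Prop :=
  ∀ r, SolvableAt G r D

/-- The probability that a distribution chosen uniformly at random among all distributions of
`t` (unlabelled) pebbles on the vertices of `G` is solvable. -/
noncomputable def solvableProb {V : Type*} [Fintype V] (G : SimpleGraph V) (t : ℕ) : ℝ :=
  ({D : V → ℕ | size D = t ∧ Solvable G D}.ncard : ℝ) / ({D : V → ℕ | size D = t}.ncard : ℝ)

/-- The set `th(G)` of pebbling thresholds of a graph sequence `G`. The members are (eventually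
positive) real functions `g` of the index such that a uniformly random distribution of `t m`
pebbles on `G m` is almost surely solvable whenever `t ≫ g`, and almost surely unsolvable
whenever `t ≪ g`. -/
def th {V : ℕ → Type*} [∀ m, Fintype (V m)] (G : ∀ m, SimpleGraph (V m)) : Set (ℕ → ℝ) :=
  {g | (∀ᶠ m in atTop, 0 < g m) ∧
    (∀ t : ℕ → ℕ, g =o[atTop] (fun m => (t m : ℝ)) →
      Tendsto (fun m => solvableProb (G m) (t m)) atTop (𝓝 1)) ∧
    (∀ t : ℕ → ℕ, (fun m => (t m : ℝ)) =o[atTop] g →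
      Tendsto (fun m => solvableProb (G m) (t m)) atTop (𝓝 0))}

/-- `G` is `k`-connected: it has more than `k` vertices, and it remains connected when any fewer
than `k` vertices are deleted. -/
def IsKConnected {V : Type*} [Fintype V] (G : SimpleGraph V) (k : ℕ) : Prop :=
  k < Fintype.card V ∧ ∀ S : Finset V, S.card < k → (G.induce {v | v ∉ S}).Connected

/-- The (vertex) connectivity of a graph: the largest `k` for which it is `k`-connected. -/
noncomputable def connectivity {V : Type*} [Fintype V] (G : SimpleGraph V) : ℕ :=
  sSup {k | IsKConnected G k}

/-- The star on `n` vertices, with centre `0`. -/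
def starG : (n : ℕ) → SimpleGraph (Fin n)
  | 0 => ⊥
  | n + 1 => SimpleGraph.starGraph (0 : Fin (n + 1))

/-- The wheel on `n` vertices: a hub `0` joined to every vertex of a cycle on the other `n - 1`
vertices. -/
def wheelG : (n : ℕ) → SimpleGraph (Fin n)
  | 0 => ⊥
  | n + 1 => SimpleGraph.starGraph (0 : Fin (n + 1)) ⊔
      (SimpleGraph.cycleGraph n).map (Fin.succEmb n)

/-- The `m`-dimensional cube, on the `2 ^ m` vertices of `{0, 1}ᵐ`; vertices are adjacent when
they differ in exactly one coordinate. -/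
def cube (m : ℕ) : SimpleGraph (Fin m → Bool) where
  Adj x y := hammingDist x y = 1
  symm := ⟨fun x y h => by rw [hammingDist_comm]; exact h⟩
  loopless := ⟨fun x h => by simp at h⟩

end Pebbling

/-!
Some of the bounds hold for every distribution, not only with high probability. If some vertex can
collect `2 ^ diam` pebbles, every root can be reached (`Solvable.of_reaches_diam`). The pigeonhole
principle provides such a vertex when the diameter is bounded; averaging over the vertices
provides one when the connectivity, hence the minimum degree, is at least `2 ^ diam`
(`solvable_of_connectivity`). On the `m`-cube, `2 ^ m` pebbles always suffice, by Chung's induction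
on the two halves of the cube with a strengthened two-pebble hypothesis
(`OddTwoPebbling.double`). On a cycle, and hence on a path, giving each
pebble on `v` the weight `2 ^ (-dist v r)` yields a total that pebbling steps do not increase, and
for fixed `v` the weights sum over the roots `r` to at most `4`; so fewer than `n / 4` pebbles
never suffice for all roots (`cycleGraph_not_solvable`).

The other bounds count distributions. With `t` pebbles the probability that two of them share a
vertex is at most `t ^ 2 / n`, and if `t < n` and no two do, then some vertex is empty and no step
is possible (`solvableProb_le_sq_div`). In a
connected graph a root fails only if `d + 1` vertices within distance `d` of it all hold fewer than
`2 ^ d` pebbles, and for `t = n ^ (1 + ε)` and `d` large in terms of `ε` this is unlikely even after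
a sum over all roots (`solvableProb_ge_of_connected`). In the star and the wheel two vertices with
two pebbles each are enough; the number of vertices with at least two pebbles has a variance not
exceeding its mean, so Chebyshev's inequality applies once the mean, of order
`n * t ^ 2 / (n + t) ^ 2`, is large (`solvableProb_ge_of_star_le`).

A threshold `g` is compared with a given size `s` by a subsequence argument: a probability of
solvability bounded away from `0` at `s` forces `g = O(s)`, and one bounded away from `1` forces
`s = O(g)` (`isBigO_of_solvableProb_ge`, `isBigO_of_solvableProb_le`).
-/

namespace Pebbling

/-! ### Sequences of pebbling steps -/

section Moves

variable {V : Type*} {G : SimpleGraph V}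

/-- `Moves G D D'`: the distribution `D` can be turned into `D'` by pebbling steps. -/
def Moves (G : SimpleGraph V) : (V → ℕ) → (V → ℕ) → Prop := Relation.ReflTransGen (Step G)

/-- `Reaches G D r k`: pebbling steps starting from `D` can put at least `k` pebbles on `r`. -/
def Reaches (G : SimpleGraph V) (D : V → ℕ) (r : V) (k : ℕ) : Prop :=
  ∃ D', Moves G D D' ∧ k ≤ D' r

theorem Step.add_right {D D' : V → ℕ} (h : Step G D D') (E : V → ℕ) :
    Step G (D + E) (D' + E) := by
  obtain ⟨u, v, huv, hu, hv, hw⟩ := h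
  refine ⟨u, v, huv, ?_, ?_, fun w h1 h2 => ?_⟩
  · simp only [Pi.add_apply]; omega
  · simp only [Pi.add_apply]; omega
  · simp only [Pi.add_apply, hw w h1 h2]

theorem Step.exists_eq_add_single [DecidableEq V] {D D' : V → ℕ} (h : Step G D D') :
    ∃ (u v : V) (E : V → ℕ), G.Adj u v ∧ D = E + Pi.single u 2 ∧ D' = E + Pi.single v 1 := by
  obtain ⟨u, v, huv, hu, hv, hw⟩ := h
  have hne := huv.ne
  refine ⟨u, v, fun x => if x = v then D v else D' x, huv, ?_, ?_⟩
  · ext x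
    by_cases h1 : x = u
    · subst h1; simp [hne, hu]
    · by_cases h2 : x = v
      · subst h2; simp [h1]
      · simp [h1, h2, hw x h1 h2]
  · ext x
    by_cases h2 : x = v
    · subst h2; simp [hv]
    · simp [h2]

theorem Moves.refl (D : V → ℕ) : Moves G D D := Relation.ReflTransGen.refl

theorem Moves.trans {D E F : V → ℕ} (h : Moves G D E) (h' : Moves G E F) : Moves G D F :=
  Relation.ReflTransGen.trans h h'

theorem Moves.add_right {D D' : V → ℕ} (h : Moves G D D') (E : V → ℕ) :
    Moves G (D + E) (D' + E) :=
  Relation.ReflTransGen.lift (· + E) (fun _ _ h => Step.add_right h E) _ _ h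

theorem Moves.add {D D' E E' : V → ℕ} (h : Moves G D D') (h' : Moves G E E') :
    Moves G (D + E) (D' + E') := by
  refine (h.add_right E).trans ?_
  rw [add_comm D', add_comm D']
  exact h'.add_right D'

theorem Moves.sum {ι : Type*} {s : Finset ι} {D D' : ι → V → ℕ}
    (h : ∀ i ∈ s, Moves G (D i) (D' i)) : Moves G (∑ i ∈ s, D i) (∑ i ∈ s, D' i) := by
  classical
  induction s using Finset.induction_on with
  | empty => exact Moves.refl _
  | insert a s ha ih =>
    rw [Finset.sum_insert ha, Finset.sum_insert ha]
    exact (h a (by simp)).add (ih fun i hi => h i (by simp [hi]))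

theorem Moves.nsmul {D D' : V → ℕ} (h : Moves G D D') (k : ℕ) : Moves G (k • D) (k • D') := by
  induction k with
  | zero => simpa using Moves.refl _
  | succ k ih => rw [succ_nsmul, succ_nsmul]; exact ih.add h

theorem moves_single [DecidableEq V] {u v : V} (h : G.Adj u v) (k : ℕ) :
    Moves G (Pi.single u (2 * k)) (Pi.single v k) := by
  have key : Moves G (Pi.single u 2) (Pi.single v 1) := by
    refine Relation.ReflTransGen.single ⟨u, v, h, ?_, ?_, fun w h1 h2 => ?_⟩
    · simp [h.ne]
    · simp [h.ne']
    · simp [h1, h2]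
  have := key.nsmul k
  rwa [← Pi.single_smul, ← Pi.single_smul, smul_eq_mul, smul_eq_mul, mul_one, mul_comm] at this

theorem Reaches.mono {D E : V → ℕ} {r : V} {k l : ℕ} (h : Reaches G D r k) (hDE : D ≤ E)
    (hkl : l ≤ k) : Reaches G E r l := by
  obtain ⟨D', hm, hk⟩ := h
  refine ⟨D' + (E - D), ?_, by simp only [Pi.add_apply]; omega⟩
  have := hm.add_right (E - D)
  rwa [add_tsub_cancel_of_le hDE] at this

theorem Reaches.add {D E : V → ℕ} {r : V} {k l : ℕ} (h : Reaches G D r k)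
    (h' : Reaches G E r l) : Reaches G (D + E) r (k + l) := by
  obtain ⟨D', hD, hk⟩ := h
  obtain ⟨E', hE, hl⟩ := h'
  exact ⟨D' + E', hD.add hE, add_le_add hk hl⟩

theorem Moves.reaches {D E : V → ℕ} {r : V} {k : ℕ} (h : Moves G D E) (h' : Reaches G E r k) :
    Reaches G D r k := by
  obtain ⟨E', hE, hk⟩ := h'
  exact ⟨E', h.trans hE, hk⟩

theorem reaches_self {D : V → ℕ} {r : V} {k : ℕ} (h : k ≤ D r) : Reaches G D r k :=
  ⟨D, Moves.refl D, h⟩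

theorem single_le_of_le [DecidableEq V] {D : V → ℕ} {v : V} {k : ℕ} (h : k ≤ D v) :
    (Pi.single v k : V → ℕ) ≤ D := by
  intro x
  by_cases hx : x = v
  · subst hx; simpa using h
  · simp [hx]

theorem Reaches.trans [DecidableEq V] {D : V → ℕ} {v r : V} {k l : ℕ} (h : Reaches G D v k)
    (h' : Reaches G (Pi.single v k) r l) : Reaches G D r l := by
  obtain ⟨D', hD, hk⟩ := h
  exact hD.reaches (h'.mono (single_le_of_le hk) le_rfl)

theorem Reaches.of_adj {D : V → ℕ} {u v : V} {k : ℕ} (h : Reaches G D u (2 * k))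
    (huv : G.Adj u v) : Reaches G D v k := by
  classical
  exact h.trans ((moves_single huv k).reaches (reaches_self (by simp)))

theorem Reaches.of_walk {D : V → ℕ} {u r : V} (p : G.Walk u r)
    (h : Reaches G D u (2 ^ p.length)) : Reaches G D r 1 := by
  induction p with
  | nil => simpa using h
  | cons huv p ih =>
    rw [SimpleGraph.Walk.length_cons, pow_succ'] at h
    exact ih (h.of_adj huv)

/-- The neighbours of `v` can move half of their pebbles to `v`. -/
theorem reaches_sum_neighbors [Fintype V] [DecidableRel G.Adj] (D : V → ℕ) (v : V) :
    Reaches G D v (∑ w with G.Adj w v, D w / 2) := by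
  classical
  have hm : Moves G (∑ w with G.Adj w v, Pi.single w (2 * (D w / 2)))
      (∑ w with G.Adj w v, Pi.single v (D w / 2)) :=
    Moves.sum fun w hw => moves_single (Finset.mem_filter.1 hw).2 _
  refine (hm.reaches (reaches_self (k := ∑ w with G.Adj w v, D w / 2) ?_)).mono ?_ le_rfl
  · simp
  · intro x
    rw [Finset.sum_apply, Finset.sum_filter]
    refine (Finset.sum_le_sum (g := fun w => if w = x then D w else 0) fun w _ => ?_).trans
      (by simp)
    by_cases hx : x = w
    · subst hx
      simp only [Pi.single_eq_same, if_true]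
      split_ifs <;> omega
    · simp [hx]

theorem Solvable.of_reaches_diam [Finite V] (hG : G.Connected) {D : V → ℕ} {v : V}
    (h : Reaches G D v (2 ^ G.diam)) : Solvable G D := by
  classical
  intro r
  obtain ⟨p, hp⟩ := hG.exists_walk_length_eq_dist v r
  have := hG.nonempty
  refine Reaches.of_walk p (h.mono le_rfl (Nat.pow_le_pow_right two_pos ?_))
  rw [hp]
  exact SimpleGraph.dist_le_diam (SimpleGraph.connected_iff_ediam_ne_top.1 hG)

theorem Solvable.mono_graph {H : SimpleGraph V} (hGH : G ≤ H) {D : V → ℕ} (h : Solvable G D) :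
    Solvable H D := by
  intro r
  obtain ⟨D', hD, hr⟩ := h r
  refine ⟨D', Relation.ReflTransGen.mono ?_ _ _ hD, hr⟩
  rintro _ _ ⟨u, v, huv, h'⟩
  exact ⟨u, v, hGH huv, h'⟩

/-- In a graph containing a star, two vertices with two pebbles each suffice: each of them sends a
pebble to the centre, if it is not the centre itself. -/
theorem solvable_of_star_le [DecidableEq V] {c u v : V} (hG : SimpleGraph.starGraph c ≤ G)
    {D : V → ℕ} (huv : u ≠ v) (hu : 2 ≤ D u) (hv : 2 ≤ D v) : Solvable G D := by
  have key : ∀ w, Reaches G (Pi.single w 2) c 1 := fun w => by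
    by_cases hw : w = c
    · subst hw; exact reaches_self (by simp)
    · exact (reaches_self (k := 2 * 1) (by simp)).of_adj
        (hG (SimpleGraph.starGraph_center_adj' (Ne.symm hw)))
  have hc : Reaches G D c 2 := ((key u).add (key v)).mono (fun x => by
    by_cases h1 : x = u
    · subst h1; simpa [huv] using hu
    · by_cases h2 : x = v
      · subst h2; simpa [h1] using hv
      · simp [h1, h2]) le_rfl
  intro r
  by_cases hr : r = c
  · subst hr; exact hc.mono le_rfl one_le_two
  · exact Reaches.of_adj (k := 1) hc (hG (SimpleGraph.starGraph_center_adj (Ne.symm hr)))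

end Moves

/-! ### Distributions that are always solvable -/

section Deterministic

variable {V : Type*} [Fintype V] {G : SimpleGraph V}

theorem exists_le_of_mul_card_le_size [Nonempty V] {D : V → ℕ} {b : ℕ}
    (h : b * Fintype.card V ≤ size D) : ∃ v, b ≤ D v := by
  obtain ⟨v, -, hv⟩ := Finset.exists_le_of_sum_le (s := Finset.univ) (f := fun _ : V => b) (g := D)
    Finset.univ_nonempty (by simpa [size, mul_comm] using h)
  exact ⟨v, hv⟩

theorem solvable_of_two_pow_diam_mul_card_le (hG : G.Connected) {D : V → ℕ}
    (h : 2 ^ G.diam * Fintype.card V ≤ size D) : Solvable G D := by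
  have := hG.nonempty
  obtain ⟨v, hv⟩ := exists_le_of_mul_card_le_size h
  exact Solvable.of_reaches_diam hG (reaches_self hv)

theorem IsKConnected.le_card_neighbors [DecidableRel G.Adj] {k : ℕ} (h : IsKConnected G k)
    (v : V) : k ≤ (Finset.univ.filter fun w => G.Adj v w).card := by
  classical
  by_contra! hlt
  set S : Finset V := Finset.univ.filter fun w => G.Adj v w with hS
  have hvS : v ∉ S := by simp [hS]
  -- `S ∪ {v}` has at most `k` elements, so there is a further vertex `w`.
  obtain ⟨w, hw⟩ : ∃ w, w ∉ insert v S := by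
    by_contra! hall
    have h1 : Fintype.card V ≤ (insert v S).card :=
      Finset.card_le_card fun x _ => hall x
    have := Finset.card_insert_le v S
    have := h.1
    omega
  rw [Finset.mem_insert, not_or] at hw
  obtain ⟨p⟩ := (h.2 S hlt).preconnected ⟨v, hvS⟩ ⟨w, hw.2⟩
  cases p with
  | nil => exact hw.1 rfl
  | @cons _ x _ hadj _ => exact x.2 (by simpa [hS] using hadj)

theorem isKConnected_connectivity (h : connectivity G ≠ 0) :
    IsKConnected G (connectivity G) := by
  have hne : {k | IsKConnected G k}.Nonempty := by
    by_contra hempty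
    rw [Set.not_nonempty_iff_eq_empty] at hempty
    exact h (by simp [connectivity, hempty])
  exact Nat.sSup_mem hne ⟨Fintype.card V, fun k hk => hk.1.le⟩

/-- By averaging, some vertex can receive at least as many pebbles from its neighbours as the
minimum degree, and this is at least `2 ^ diam`. -/
theorem solvable_of_connectivity (hG : G.Connected) (hk : 2 ^ G.diam ≤ connectivity G) {D : V → ℕ}
    (h : 3 * Fintype.card V ≤ size D) : Solvable G D := by
  classical
  have := hG.nonempty
  set k := connectivity G with hkdef
  have hconn : IsKConnected G k :=
    isKConnected_connectivity ((pow_pos two_pos G.diam).trans_le hk).ne'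
  have hhalf : Fintype.card V ≤ ∑ w, D w / 2 := by
    have h1 : ∑ w, D w ≤ ∑ w, (2 * (D w / 2) + 1) := Finset.sum_le_sum fun w _ => by omega
    rw [Finset.sum_add_distrib, ← Finset.mul_sum] at h1
    simp only [size, Finset.sum_const, Finset.card_univ, smul_eq_mul, mul_one] at h h1
    omega
  have hsum : ∑ _v : V, k ≤ ∑ v, ∑ w with G.Adj w v, D w / 2 := by
    calc ∑ _v : V, k = k * Fintype.card V := by simp [mul_comm]
      _ ≤ k * ∑ w, D w / 2 := Nat.mul_le_mul_left _ hhalf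
      _ = ∑ w, k * (D w / 2) := Finset.mul_sum _ _ _
      _ ≤ ∑ w, ∑ v with G.Adj w v, D w / 2 := Finset.sum_le_sum fun w _ => by
          rw [Finset.sum_const, smul_eq_mul]
          exact Nat.mul_le_mul_right _ (hconn.le_card_neighbors w)
      _ = ∑ v, ∑ w with G.Adj w v, D w / 2 := by
          simp_rw [Finset.sum_filter]
          exact Finset.sum_comm
  obtain ⟨v, -, hv⟩ := Finset.exists_le_of_sum_le Finset.univ_nonempty hsum
  exact Solvable.of_reaches_diam hG ((reaches_sum_neighbors D v).mono le_rfl (hk.trans hv))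

/-- Every vertex of a connected graph has a set of `d + 1` vertices within distance `d`. -/
theorem exists_finset_walk_length_le (hG : G.Connected) (r : V) {d : ℕ}
    (hd : d < Fintype.card V) :
    ∃ A : Finset V, A.card = d + 1 ∧ ∀ v ∈ A, ∃ p : G.Walk v r, p.length ≤ d := by
  classical
  induction d with
  | zero => exact ⟨{r}, by simp, by simp⟩
  | succ d ih =>
    obtain ⟨A, hA, hw⟩ := ih (by omega)
    have hAne : A.Nonempty := Finset.card_pos.1 (by omega)
    obtain ⟨a, ha⟩ := hAne
    obtain ⟨b, hb⟩ : ∃ b, b ∉ A := by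
      by_contra! hall
      have : Fintype.card V ≤ A.card := Finset.card_le_card fun x _ => hall x
      omega
    obtain ⟨q⟩ := hG.preconnected a b
    obtain ⟨e, -, he1, he2⟩ := q.exists_boundary_dart (A : Set V) (by simpa using ha)
      (by simpa using hb)
    refine ⟨insert e.snd A, by rw [Finset.card_insert_of_notMem (by simpa using he2), hA], ?_⟩
    intro v hv
    rcases Finset.mem_insert.1 hv with rfl | hv
    · obtain ⟨p, hp⟩ := hw e.fst (by simpa using he1)
      exact ⟨.cons e.adj.symm p, by simpa using hp⟩
    · obtain ⟨p, hp⟩ := hw v hv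
      exact ⟨p, by omega⟩

end Deterministic

/-! ### Distributions that are never solvable -/

section Weights

variable {V : Type*} [Fintype V] {G : SimpleGraph V}

/-- A weighting that at most doubles along each edge gives every distribution a total weight that
pebbling steps do not increase. -/
theorem Moves.weight_le {w : V → ℝ} (hw : ∀ u v, G.Adj u v → w v ≤ 2 * w u) {D D' : V → ℕ}
    (h : Moves G D D') : ∑ v, D' v * w v ≤ ∑ v, D v * w v := by
  classical
  induction h with
  | refl => exact le_rfl
  | tail _ hstep ih =>
    refine le_trans ?_ ih
    obtain ⟨u, v, E, huv, rfl, rfl⟩ := hstep.exists_eq_add_single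
    have hs : ∀ (x : V) (k : ℕ), ∑ y, ((E + Pi.single x k : V → ℕ) y : ℝ) * w y
        = ∑ y, E y * w y + k * w x := fun x k => by
      simp [add_mul, Finset.sum_add_distrib, Pi.single_apply]
    rw [hs, hs]
    have := hw u v huv
    push_cast
    linarith

/-- The weights centred at the different roots are averaged: if they sum to at most `K`, then a
distribution solvable at all roots has at least `card V / K` pebbles. -/
theorem Solvable.card_le_mul_size {w : V → V → ℝ} {K : ℝ} (hpos : ∀ r v, 0 ≤ w r v)
    (hself : ∀ r, 1 ≤ w r r) (hw : ∀ r u v, G.Adj u v → w r v ≤ 2 * w r u)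
    (hK : ∀ v, ∑ r, w r v ≤ K) {D : V → ℕ} (h : Solvable G D) :
    (Fintype.card V : ℝ) ≤ K * size D := by
  have h1 : ∀ r, 1 ≤ ∑ v, D v * w r v := fun r => by
    obtain ⟨D', hm, hr⟩ := h r
    have h2 := Moves.weight_le (hw r) hm
    refine le_trans ?_ h2
    calc (1 : ℝ) ≤ D' r * w r r := by
          have : (1 : ℝ) ≤ D' r := by exact_mod_cast hr
          nlinarith [hself r]
      _ ≤ ∑ v, D' v * w r v := Finset.single_le_sum (f := fun v => (D' v : ℝ) * w r v)
          (fun v _ => mul_nonneg (by positivity) (hpos r v)) (Finset.mem_univ r)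
  calc (Fintype.card V : ℝ) = ∑ _r : V, (1 : ℝ) := by simp
    _ ≤ ∑ r, ∑ v, D v * w r v := Finset.sum_le_sum fun r _ => h1 r
    _ = ∑ v, D v * ∑ r, w r v := by
        rw [Finset.sum_comm]
        simp_rw [Finset.mul_sum]
    _ ≤ ∑ v, D v * K := Finset.sum_le_sum fun v _ =>
        mul_le_mul_of_nonneg_left (hK v) (by positivity)
    _ = K * size D := by rw [← Finset.sum_mul, size, Nat.cast_sum, mul_comm]

theorem cycleGraph_not_solvable {n : ℕ} {D : Fin n → ℕ} (h : 4 * size D < n) :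
    ¬ Solvable (SimpleGraph.cycleGraph n) D := by
  intro hsol
  -- The distance on the cycle from `0` to `x` is the smaller of `x` and `n - x`.
  let c : Fin n → ℕ := fun x => min x.val (n - x.val)
  obtain _ | n := n
  · omega
  have hc : ∀ x y : Fin (n + 1), y = x + 1 → c x ≤ c y + 1 ∧ c y ≤ c x + 1 := by
    rintro x _ rfl
    have hx := x.2
    simp only [c, Fin.val_add_one]
    split_ifs with hl
    · subst hl; simp
    · omega
  have hG : ∀ u v : Fin (n + 1), (SimpleGraph.cycleGraph (n + 1)).Adj u v →
      v = u + 1 ∨ u = v + 1 := by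
    intro u v huv
    obtain _ | n := n
    · exact absurd (Subsingleton.elim (α := Fin 1) u v) huv.ne
    · rw [SimpleGraph.cycleGraph_adj] at huv
      rcases huv with h | h
      · right; rw [← h]; abel
      · left; rw [← h]; abel
  have key := hsol.card_le_mul_size (w := fun r v => (1 / 2 : ℝ) ^ c (v - r)) (K := 4)
    (fun r v => by positivity) (fun r => by simp [c]) ?_ ?_
  · have : ((n + 1 : ℕ) : ℝ) ≤ ((4 * size D : ℕ) : ℝ) := by simpa using key
    have := Nat.cast_le.1 this
    omega
  · intro r u v huv
    have h1 : c (u - r) ≤ c (v - r) + 1 := by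
      rcases hG u v huv with h | h
      · exact (hc _ _ (by rw [h]; abel)).1
      · exact (hc _ _ (by rw [h]; abel)).2
    have := pow_le_pow_of_le_one (by norm_num : (0 : ℝ) ≤ 1 / 2) (by norm_num) h1
    rw [pow_succ] at this
    show (1 / 2 : ℝ) ^ c (v - r) ≤ 2 * (1 / 2 : ℝ) ^ c (u - r)
    linarith
  · intro v
    calc ∑ r, (1 / 2 : ℝ) ^ c (v - r) = ∑ x, (1 / 2 : ℝ) ^ c x :=
          Equiv.sum_comp (Equiv.subLeft v) fun x => (1 / 2 : ℝ) ^ c x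
      _ ≤ ∑ x : Fin (n + 1), ((1 / 2 : ℝ) ^ x.val + (1 / 2 : ℝ) ^ (n + 1 - 1 - x.val)) := by
          refine Finset.sum_le_sum fun x _ => ?_
          have hp : ∀ k : ℕ, (0 : ℝ) ≤ (1 / 2) ^ k := fun k => by positivity
          rcases min_choice x.val (n + 1 - x.val) with h | h
          · simp only [c, h]; linarith [hp (n + 1 - 1 - x.val)]
          · simp only [c, h]
            have := pow_le_pow_of_le_one (by norm_num : (0 : ℝ) ≤ 1 / 2) (by norm_num)
              (by omega : n + 1 - 1 - x.val ≤ n + 1 - x.val)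
            linarith [hp x.val]
      _ ≤ 4 := by
          rw [Finset.sum_add_distrib, Fin.sum_univ_eq_sum_range (fun i => (1 / 2 : ℝ) ^ i),
            Fin.sum_univ_eq_sum_range (fun i => (1 / 2 : ℝ) ^ (n + 1 - 1 - i)),
            Finset.sum_range_reflect (fun i => (1 / 2 : ℝ) ^ i)]
          have := sum_geometric_two_le (n + 1)
          linarith

end Weights

/-! ### The pebbling number of the cube -/

section Cube

variable {V W : Type*} {G : SimpleGraph V} {H : SimpleGraph W}

/-- The number of vertices holding an odd number of pebbles. -/
def numOdd [Fintype V] (D : V → ℕ) : ℕ := ∑ v, D v % 2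

/-- The inductive property behind the pebbling number of the cube: `N` pebbles suffice to reach
any root, and `2 * N + 1` suffice to put two pebbles there, where the vertices holding an odd
number of pebbles are counted with one additional pebble. -/
def OddTwoPebbling [Fintype V] (G : SimpleGraph V) (N : ℕ) : Prop :=
  Fintype.card V ≤ N ∧ ∀ (D : V → ℕ) (r : V), (N ≤ size D → Reaches G D r 1) ∧
    (2 * N < size D + numOdd D → Reaches G D r 2)

theorem size_add [Fintype V] (D E : V → ℕ) : size (D + E) = size D + size E :=
  Finset.sum_add_distrib

theorem exists_le_size_eq [Fintype V] (D : V → ℕ) {k : ℕ} (hk : k ≤ size D) :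
    ∃ E ≤ D, size E = k := by
  classical
  induction k with
  | zero => exact ⟨0, fun _ => Nat.zero_le _, by simp [size]⟩
  | succ k ih =>
    obtain ⟨E, hE, hs⟩ := ih (by omega)
    obtain ⟨v, -, hv⟩ : ∃ v ∈ Finset.univ, E v < D v :=
      Finset.exists_lt_of_sum_lt (by simp only [size] at hs hk; omega)
    refine ⟨E + Pi.single v 1, fun x => ?_, by rw [size_add, hs]; simp [size]⟩
    by_cases hx : x = v
    · subst hx; simpa using hv
    · simpa [hx] using hE x

/-- The distribution on two copies of `V` that is `D` on copy `b` and empty on the other. -/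
def lift (e : Bool × V ≃ W) (b : Bool) (D : V → ℕ) : W → ℕ :=
  fun w => if (e.symm w).1 = b then D (e.symm w).2 else 0

theorem lift_add (e : Bool × V ≃ W) (b : Bool) (D E : V → ℕ) :
    lift e b (D + E) = lift e b D + lift e b E := by
  ext w
  simp only [lift, Pi.add_apply]
  split_ifs <;> simp

theorem lift_add_lift_not (e : Bool × V ≃ W) (b : Bool) (D : W → ℕ) :
    lift e b (fun x => D (e (b, x))) + lift e (!b) (fun x => D (e (!b, x))) = D := by
  ext w
  obtain ⟨⟨c, x⟩, rfl⟩ := e.surjective w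
  cases b <;> cases c <;> simp [lift]

theorem lift_single [DecidableEq V] [DecidableEq W] (e : Bool × V ≃ W) (b : Bool) (x : V) (k : ℕ) :
    lift e b (Pi.single x k) = Pi.single (e (b, x)) k := by
  ext w
  obtain ⟨⟨c, y⟩, rfl⟩ := e.surjective w
  by_cases h1 : c = b <;> by_cases h2 : y = x <;> simp [lift, h1, h2]

theorem Moves.lift {e : Bool × V ≃ W} {b : Bool}
    (he : ∀ x y, G.Adj x y → H.Adj (e (b, x)) (e (b, y))) {D D' : V → ℕ} (h : Moves G D D') :
    Moves H (lift e b D) (lift e b D') := by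
  classical
  induction h with
  | refl => exact Moves.refl _
  | tail _ hstep ih =>
    refine ih.trans ?_
    obtain ⟨u, v, E, huv, rfl, rfl⟩ := hstep.exists_eq_add_single
    rw [lift_add, lift_add, lift_single, lift_single]
    exact (Moves.refl _).add (moves_single (he u v huv) 1)

theorem Reaches.lift {e : Bool × V ≃ W} {b : Bool}
    (he : ∀ x y, G.Adj x y → H.Adj (e (b, x)) (e (b, y))) {D : V → ℕ} {r : V} {k : ℕ}
    (h : Reaches G D r k) : Reaches H (lift e b D) (e (b, r)) k := by
  obtain ⟨D', hm, hk⟩ := h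
  exact ⟨_, hm.lift he, by simpa [Pebbling.lift] using hk⟩

/-- Pairs of pebbles can be moved from one copy to the other along a perfect matching. -/
theorem moves_lift_not [Fintype V] {e : Bool × V ≃ W} {b : Bool}
    (he : ∀ x, H.Adj (e (!b, x)) (e (b, x))) (E : V → ℕ) :
    Moves H (lift e (!b) (2 * E)) (lift e b E) := by
  classical
  have hm : Moves H (∑ x, Pi.single (e (!b, x)) (2 * E x)) (∑ x, Pi.single (e (b, x)) (E x)) :=
    Moves.sum fun x _ => moves_single (he x) _
  have hs : ∀ (c : Bool) (F : V → ℕ), ∑ x, Pi.single (e (c, x)) (F x) = lift e c F := by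
    intro c F
    ext w
    obtain ⟨⟨c', y⟩, rfl⟩ := e.surjective w
    rw [Finset.sum_apply]
    by_cases h1 : c' = c <;> simp [lift, h1, Pi.single_apply]
  rw [hs b] at hm
  have := hs (!b) (2 * E)
  simp only [Pi.mul_apply, Pi.ofNat_apply] at this
  rwa [this] at hm

/-- Chung's argument: if the copy of the root holds too few pebbles, pairs of pebbles are
moved over from the other copy; otherwise the other copy can put two pebbles on the neighbour of
the root in it. -/
theorem OddTwoPebbling.double [Fintype V] [Fintype W] {N : ℕ} (h : OddTwoPebbling G N)
    (e : Bool × V ≃ W)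
    (he : ∀ b x y, G.Adj x y → H.Adj (e (b, x)) (e (b, y)))
    (he' : ∀ b x, H.Adj (e (!b, x)) (e (b, x))) : OddTwoPebbling H (2 * N) := by
  refine ⟨?_, fun D w => ?_⟩
  · rw [← Fintype.card_congr e]
    simpa using h.1
  obtain ⟨⟨b, r⟩, rfl⟩ := e.surjective w
  set D₀ : V → ℕ := fun x => D (e (b, x)) with hD₀
  set D₁ : V → ℕ := fun x => D (e (!b, x)) with hD₁
  have hD : lift e b D₀ + lift e (!b) D₁ = D := lift_add_lift_not e b D
  have hsum : ∀ f : ℕ → ℕ, ∑ w, f (D w) = ∑ x, f (D₀ x) + ∑ x, f (D₁ x) := by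
    intro f
    rw [← Equiv.sum_comp e, Fintype.sum_prod_type, Fintype.sum_bool]
    cases b
    · exact add_comm _ _
    · rfl
  have hsize : size D = size D₀ + size D₁ := hsum id
  have hodd : numOdd D = numOdd D₀ + numOdd D₁ := hsum (· % 2)
  have hle₀ : lift e b D₀ ≤ D := by rw [← hD]; exact le_self_add
  have hle₁ : lift e (!b) D₁ ≤ D := by rw [← hD]; exact le_add_self
  have hodd_le : ∀ F : V → ℕ, numOdd F ≤ size F ∧ numOdd F ≤ N := fun F =>
    ⟨Finset.sum_le_sum fun x _ => Nat.mod_le _ _,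
      le_trans (by
        refine (Finset.sum_le_sum (g := fun _ => 1) fun x _ => ?_).trans (by simp)
        show F x % 2 ≤ 1
        omega) h.1⟩
  obtain ⟨ho0, -⟩ := hodd_le D₀
  obtain ⟨-, ho1⟩ := hodd_le D₁
  -- Halving the pebbles of the other copy loses one pebble at each odd vertex.
  have hhalf : size D₁ = 2 * size (fun x => D₁ x / 2) + numOdd D₁ := by
    simp only [size, numOdd, Finset.mul_sum, ← Finset.sum_add_distrib]
    exact Finset.sum_congr rfl fun x _ => by omega
  have hcross : ∀ F : V → ℕ, 2 * N < size F + numOdd F →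
      Reaches H (lift e (!b) F) (e (b, r)) 1 := fun F hF =>
    Reaches.of_adj (k := 1) (((h.2 F r).2 hF).lift (he (!b))) (he' b r)
  have htransfer : ∀ E : V → ℕ, N ≤ size D₀ + size E →
      Reaches H (lift e b D₀ + lift e (!b) (2 * E)) (e (b, r)) 1 := fun E hE => by
    refine ((Moves.refl _).add (moves_lift_not (he' b) E)).reaches ?_
    rw [← lift_add]
    exact ((h.2 _ r).1 (by rwa [size_add])).lift (he b)
  constructor
  · intro hN
    by_cases h1 : 2 * N < size D₁ + numOdd D₁
    · exact (hcross D₁ h1).mono hle₁ le_rfl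
    · refine (htransfer (fun x => D₁ x / 2) (by omega)).mono ?_ le_rfl
      rw [← hD]
      refine add_le_add_right ?_ _
      intro w
      simp only [lift]
      split_ifs
      · simp only [Pi.mul_apply, Pi.ofNat_apply]; omega
      · exact le_rfl
  · intro hN
    by_cases h0 : 2 * N < size D₀ + numOdd D₀
    · exact (((h.2 D₀ r).2 h0).lift (he b)).mono hle₀ le_rfl
    have h1 : 2 * N < size D₁ + numOdd D₁ := by omega
    by_cases h2 : N ≤ size D₀
    · have := (((h.2 D₀ r).1 h2).lift (he b)).add (hcross D₁ h1)
      rwa [hD] at this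
    · -- Move exactly enough pairs to fill the copy of the root up to `N` pebbles; this keeps the
      -- number of odd vertices, so two pebbles still reach the neighbour of the root.
      obtain ⟨E, hE, hsE⟩ := exists_le_size_eq (fun x => D₁ x / 2) (k := N - size D₀) (by omega)
      have hEF : D₁ = 2 * E + (fun x => D₁ x - 2 * E x) := by
        ext x
        have : E x ≤ D₁ x / 2 := hE x
        simp only [Pi.add_apply, Pi.mul_apply, Pi.ofNat_apply]
        omega
      set F : V → ℕ := fun x => D₁ x - 2 * E x with hF
      have hsF : size D₁ = 2 * size E + size F := by
        rw [hEF, size_add]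
        simp [size, Finset.mul_sum]
      have hoF : numOdd D₁ = numOdd F := by
        rw [hEF]
        refine Finset.sum_congr rfl fun x _ => ?_
        simp only [Pi.add_apply, Pi.mul_apply, Pi.ofNat_apply]
        omega
      have := (htransfer E (by omega)).add (hcross F (by omega))
      rwa [add_assoc, ← lift_add, ← hEF, hD] at this

theorem cube_oddTwoPebbling (m : ℕ) : OddTwoPebbling (cube m) (2 ^ m) := by
  induction m with
  | zero =>
    refine ⟨by simp, fun D r => ?_⟩
    have hr : ∀ f : (Fin 0 → Bool) → ℕ, ∑ x, f x = f r := fun f => by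
      rw [Fintype.sum_unique]
      exact congrArg f (Subsingleton.elim _ _)
    simp only [size, numOdd, hr, pow_zero]
    exact ⟨fun h => reaches_self h, fun h => reaches_self (by omega)⟩
  | succ m ih =>
    rw [pow_succ']
    refine ih.double (Fin.consEquiv fun _ => Bool) (fun b x y hxy => ?_) (fun b x => ?_)
    · change hammingDist _ _ = 1
      have hxy : hammingDist x y = 1 := hxy
      refine Eq.trans ?_ hxy
      simp only [hammingDist, Finset.card_filter, Fin.sum_univ_succ]
      simp [Fin.consEquiv]
    · change hammingDist _ _ = 1
      simp only [hammingDist, Finset.card_filter, Fin.sum_univ_succ]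
      simp [Fin.consEquiv]

theorem cube_solvable {m : ℕ} {D : (Fin m → Bool) → ℕ} (h : 2 ^ m ≤ size D) :
    Solvable (cube m) D :=
  fun r => ((cube_oddTwoPebbling m).2 D r).1 h

end Cube

/-! ### Counting distributions -/

section Counting

theorem multichoose_succ_right_mul (n t : ℕ) :
    Nat.multichoose n (t + 1) * (t + 1) = (n + t) * Nat.multichoose n t := by
  rcases n with _ | n
  · rcases t with _ | t <;> simp
  · rw [Nat.multichoose_eq, Nat.multichoose_eq]
    have := Nat.add_one_mul_choose_eq (n + t) t
    rw [show n + 1 + (t + 1) - 1 = n + t + 1 by omega, show n + 1 + t - 1 = n + t by omega, ← this]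
    ring

theorem multichoose_mul_add (n t : ℕ) :
    Nat.multichoose n t * (n + t) = n * Nat.multichoose (n + 1) t := by
  rcases n with _ | n
  · rcases t with _ | t <;> simp
  · rw [Nat.multichoose_eq, Nat.multichoose_eq]
    have := Nat.choose_mul_succ_eq (n + t) t
    rw [show n + t + 1 - t = n + 1 by omega] at this
    rw [show n + 1 + 1 + t - 1 = n + t + 1 by omega, show n + 1 + t - 1 = n + t by omega]
    linarith

theorem multichoose_mul_pow_le (b a t : ℕ) :
    Nat.multichoose b t * t ^ a ≤ (b + a) ^ a * Nat.multichoose (b + a) t := by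
  induction a with
  | zero => simp
  | succ a ih =>
    calc Nat.multichoose b t * t ^ (a + 1) = Nat.multichoose b t * t ^ a * t := by ring
      _ ≤ (b + a) ^ a * Nat.multichoose (b + a) t * (b + a + t) := Nat.mul_le_mul ih (by omega)
      _ = (b + a) ^ a * ((b + a) * Nat.multichoose (b + a + 1) t) := by
          rw [mul_assoc, multichoose_mul_add]
      _ = (b + a) ^ (a + 1) * Nat.multichoose (b + (a + 1)) t := by ring_nf
      _ ≤ (b + (a + 1)) ^ (a + 1) * Nat.multichoose (b + (a + 1)) t :=
          Nat.mul_le_mul_right _ (Nat.pow_le_pow_left (by omega) _)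

theorem multichoose_mono_right {n : ℕ} (hn : 1 ≤ n) : Monotone (Nat.multichoose n) := by
  refine monotone_nat_of_le_succ fun t => ?_
  have h := multichoose_succ_right_mul n t
  refine Nat.le_of_mul_le_mul_right (c := t + 1) ?_ (by omega)
  rw [h, mul_comm]
  exact Nat.mul_le_mul_right _ (by omega)

theorem multichoose_pos {n : ℕ} (hn : 1 ≤ n) (t : ℕ) : 0 < Nat.multichoose n t :=
  lt_of_lt_of_le (by simp) (multichoose_mono_right hn (Nat.zero_le t))

theorem multichoose_add_two (n s : ℕ) :
    Nat.multichoose n (s + 2) * ((s + 2) * (s + 1)) =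
      (n + s + 1) * (n + s) * Nat.multichoose n s := by
  have h1 := multichoose_succ_right_mul n s
  have h2 := multichoose_succ_right_mul n (s + 1)
  calc Nat.multichoose n (s + 2) * ((s + 2) * (s + 1))
      = (Nat.multichoose n (s + 1 + 1) * (s + 1 + 1)) * (s + 1) := by ring
    _ = (n + (s + 1)) * (Nat.multichoose n (s + 1) * (s + 1)) := by rw [h2]; ring
    _ = _ := by rw [h1]; ring

/-- Log-concavity of the number of distributions, in steps of two. -/
theorem multichoose_mul_multichoose_le {n : ℕ} (hn : 1 ≤ n) (s : ℕ) :
    Nat.multichoose n s * Nat.multichoose n (s + 4) ≤ Nat.multichoose n (s + 2) ^ 2 := by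
  have h1 := multichoose_add_two n s
  have h2 := multichoose_add_two n (s + 2)
  set a := Nat.multichoose n s
  set b := Nat.multichoose n (s + 2)
  set c := Nat.multichoose n (s + 4)
  change c * ((s + 4) * (s + 3)) = _ at h2
  obtain ⟨k, rfl⟩ := Nat.exists_eq_add_of_le hn
  have hp : (1 + k + (s + 2) + 1) * (1 + k + (s + 2)) * ((s + 2) * (s + 1))
      ≤ (1 + k + s + 1) * (1 + k + s) * ((s + 4) * (s + 3)) := by
    have e1 : (1 + k + (s + 2) + 1) * (s + 2) ≤ (1 + k + s + 1) * (s + 4) := by nlinarith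
    have e2 : (1 + k + (s + 2)) * (s + 1) ≤ (1 + k + s) * (s + 3) := by nlinarith
    calc _ = (1 + k + (s + 2) + 1) * (s + 2) * ((1 + k + (s + 2)) * (s + 1)) := by ring
      _ ≤ (1 + k + s + 1) * (s + 4) * ((1 + k + s) * (s + 3)) := Nat.mul_le_mul e1 e2
      _ = _ := by ring
  refine Nat.le_of_mul_le_mul_right (c := (1 + k + s + 1) * (1 + k + s) * ((s + 4) * (s + 3))) ?_
    (by positivity)
  calc a * c * ((1 + k + s + 1) * (1 + k + s) * ((s + 4) * (s + 3)))
      = ((1 + k + s + 1) * (1 + k + s) * a) * (c * ((s + 4) * (s + 3))) := by ring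
    _ = b ^ 2 * ((1 + k + (s + 2) + 1) * (1 + k + (s + 2)) * ((s + 2) * (s + 1))) := by
        rw [← h1, h2]; ring
    _ ≤ b ^ 2 * ((1 + k + s + 1) * (1 + k + s) * ((s + 4) * (s + 3))) := Nat.mul_le_mul_left _ hp

theorem card_piAntidiag_nat {V : Type*} [DecidableEq V] (A : Finset V) (t : ℕ) :
    (A.piAntidiag t).card = Nat.multichoose A.card t := by
  rw [← Finset.card_finsuppAntidiag_nat_eq_multichoose, Finset.finsuppAntidiag, Finset.card_map,
    Finset.card_attach]

variable {V : Type*} [Fintype V]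

open Classical in
/-- The finite set of all distributions of size `t` on the vertex set `V`. -/
noncomputable def dists (V : Type*) [Fintype V] (t : ℕ) : Finset (V → ℕ) :=
  Finset.univ.piAntidiag t

theorem mem_dists {D : V → ℕ} {t : ℕ} : D ∈ dists V t ↔ size D = t := by
  simp [dists, size]

theorem card_dists (t : ℕ) : (dists V t).card = Nat.multichoose (Fintype.card V) t := by
  classical
  rw [dists, card_piAntidiag_nat, Finset.card_univ]

theorem card_dists_pos [Nonempty V] (t : ℕ) : 0 < ((dists V t).card : ℝ) := by
  rw [card_dists]
  exact_mod_cast multichoose_pos Fintype.card_pos t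

open Classical in
theorem solvableProb_eq (G : SimpleGraph V) (t : ℕ) :
    solvableProb G t = (((dists V t).filter (Solvable G)).card : ℝ) / (dists V t).card := by
  rw [solvableProb, ← Set.ncard_coe_finset, ← Set.ncard_coe_finset]
  congr 3 <;> ext D <;> simp [mem_dists]

theorem solvableProb_nonneg (G : SimpleGraph V) (t : ℕ) : 0 ≤ solvableProb G t := by
  unfold solvableProb; positivity

theorem solvableProb_le_one (G : SimpleGraph V) (t : ℕ) : solvableProb G t ≤ 1 := by
  classical
  rw [solvableProb_eq]
  exact div_le_one_of_le₀ (by exact_mod_cast Finset.card_filter_le _ _) (by positivity)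

theorem solvableProb_eq_zero {G : SimpleGraph V} {t : ℕ}
    (h : ∀ D : V → ℕ, size D = t → ¬ Solvable G D) : solvableProb G t = 0 := by
  classical
  rw [solvableProb_eq, Finset.filter_false_of_mem fun D hD => h D (mem_dists.1 hD)]
  simp

open Classical in
theorem solvableProb_ge [Nonempty V] {G : SimpleGraph V} {t : ℕ} {c : ℝ}
    (h : (((dists V t).filter fun D => ¬ Solvable G D).card : ℝ) ≤ c * (dists V t).card) :
    1 - c ≤ solvableProb G t := by
  rw [solvableProb_eq, le_div_iff₀ (card_dists_pos t)]
  have := Finset.card_filter_add_card_filter_not (s := dists V t) (Solvable G)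
  have : (((dists V t).filter (Solvable G)).card : ℝ) +
    ((dists V t).filter fun D => ¬ Solvable G D).card = (dists V t).card := by exact_mod_cast this
  linarith

theorem solvableProb_ge_one [Nonempty V] {G : SimpleGraph V} {t : ℕ}
    (h : ∀ D : V → ℕ, size D = t → Solvable G D) : 1 ≤ solvableProb G t := by
  classical
  have := solvableProb_ge (G := G) (t := t) (c := 0) (by
    rw [Finset.filter_false_of_mem fun D hD => not_not.2 (h D (mem_dists.1 hD))]
    simp)
  linarith

open Classical in
/-- Placing the pebbles of `f` first, the distributions above `f` are those of the other
pebbles. -/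
theorem card_filter_le_dists (f : V → ℕ) (s : ℕ) :
    ((dists V (s + size f)).filter fun D => f ≤ D).card = (dists V s).card := by
  rw [← Finset.card_image_of_injective (dists V s) (add_left_injective f)]
  congr 1
  ext D
  simp only [Finset.mem_filter, Finset.mem_image, mem_dists]
  constructor
  · rintro ⟨hD, hf⟩
    refine ⟨D - f, ?_, tsub_add_cancel_of_le hf⟩
    have := size_add (D - f) f
    rw [tsub_add_cancel_of_le hf] at this
    omega
  · rintro ⟨E, hE, rfl⟩
    exact ⟨by rw [size_add, hE], le_add_self⟩

open Classical in
theorem card_filter_two_le (v : V) (s : ℕ) :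
    ((dists V (s + 2)).filter fun D => 2 ≤ D v).card = Nat.multichoose (Fintype.card V) s := by
  have h := card_filter_le_dists (Pi.single v 2 : V → ℕ) s
  rw [show size (Pi.single v 2 : V → ℕ) = 2 by simp [size], card_dists] at h
  rw [← h]
  congr 1
  ext D
  simp only [Finset.mem_filter, and_congr_right_iff]
  exact fun _ => ⟨single_le_of_le, fun h => by simpa using h v⟩

open Classical in
theorem card_filter_two_le_two_le {u v : V} (huv : u ≠ v) (s : ℕ) :
    ((dists V (s + 4)).filter fun D => 2 ≤ D u ∧ 2 ≤ D v).card =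
      Nat.multichoose (Fintype.card V) s := by
  have h := card_filter_le_dists (Pi.single u 2 + Pi.single v 2 : V → ℕ) s
  rw [size_add, show size (Pi.single u 2 : V → ℕ) = 2 by simp [size],
    show size (Pi.single v 2 : V → ℕ) = 2 by simp [size], card_dists] at h
  rw [← h]
  congr 1
  ext D
  simp only [Finset.mem_filter, and_congr_right_iff]
  refine fun _ => ⟨fun hD x => ?_, fun h => ⟨?_, ?_⟩⟩
  · by_cases h1 : x = u
    · subst h1; simpa [huv] using hD.1
    · by_cases h2 : x = v
      · subst h2; simpa [h1] using hD.2
      · simp [h1, h2]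
  · simpa [huv] using h u
  · simpa [huv.symm] using h v

open Classical in
/-- The distributions with fewer than `B` pebbles on each vertex of `A` are counted by their values
on `A` and the distribution of the remaining pebbles off `A`. -/
theorem card_filter_lt_le {A : Finset V} (hA : A.card < Fintype.card V) (B t : ℕ) :
    ((dists V t).filter fun D => ∀ v ∈ A, D v < B).card ≤
      Nat.multichoose (Fintype.card V - A.card) t * B ^ A.card := by
  let T : Finset (V → ℕ) := Fintype.piFinset fun v => if v ∈ A then Finset.range B else {0}
  have hT : T.card = B ^ A.card := by
    rw [Fintype.card_piFinset]
    simp only [apply_ite Finset.card, Finset.card_range, Finset.card_singleton]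
    rw [Finset.prod_ite_mem, Finset.univ_inter, Finset.prod_const]
  rw [← hT]
  refine Finset.card_le_mul_card_image_of_maps_to (f := fun D v => if v ∈ A then D v else 0) ?_ _ ?_
  · intro D hD
    simp only [Finset.mem_filter] at hD
    simp only [T, Fintype.mem_piFinset]
    intro v
    by_cases hv : v ∈ A
    · simpa [hv] using hD.2 v hv
    · simp [hv]
  · intro f _
    rw [← Finset.card_compl]
    have hc : 1 ≤ Aᶜ.card := by rw [Finset.card_compl]; omega
    refine le_trans ?_ (multichoose_mono_right hc (Nat.sub_le t (size f)))
    rw [← card_piAntidiag_nat]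
    refine Finset.card_le_card_of_injOn (fun D => D - f) ?_ ?_
    · intro D hD
      simp only [Finset.coe_filter, Finset.mem_filter, mem_dists, Set.mem_ofPred_eq] at hD
      obtain ⟨⟨hD, -⟩, rfl⟩ := hD
      simp only [Finset.mem_coe, Finset.mem_piAntidiag, Pi.sub_apply]
      refine ⟨?_, fun i hi => ?_⟩
      · rw [← hD, size, size, ← Finset.sum_add_sum_compl A]
        simp only [Finset.sum_ite_mem, Finset.univ_inter]
        rw [add_tsub_cancel_left]
        refine Finset.sum_congr rfl fun x hx => ?_
        simp [Finset.mem_compl.1 hx]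
      · rw [Finset.mem_compl]
        intro hiA
        simp [hiA] at hi
    · intro D hD E hE hDE
      simp only [Finset.coe_filter, Finset.mem_filter, mem_dists, Set.mem_ofPred_eq] at hD hE
      have h1 : f ≤ D := by
        rw [← hD.2]; intro v; dsimp only; split_ifs <;> simp
      have h2 : f ≤ E := by
        rw [← hE.2]; intro v; dsimp only; split_ifs <;> simp
      rw [← tsub_add_cancel_of_le h1, ← tsub_add_cancel_of_le h2]
      exact congrArg (· + f) hDE

end Counting

/-! ### Estimates of the probability of solvability -/

section Probability

variable {V : Type*} [Fintype V] {G : SimpleGraph V}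

theorem not_solvable_of_le_one {D : V → ℕ} (hD : ∀ v, D v ≤ 1) (hs : size D < Fintype.card V) :
    ¬ Solvable G D := by
  intro h
  obtain ⟨r, hr⟩ : ∃ r, D r = 0 := by
    by_contra! hne
    have : ∑ _v : V, 1 ≤ ∑ v, D v := Finset.sum_le_sum fun v _ => Nat.one_le_iff_ne_zero.2 (hne v)
    simp only [Finset.sum_const, Finset.card_univ, smul_eq_mul, mul_one] at this
    exact absurd hs (not_lt.2 this)
  obtain ⟨D', hm, hr'⟩ := h r
  rcases Relation.ReflTransGen.cases_head hm with rfl | ⟨E, ⟨u, v, -, hu, -⟩, -⟩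
  · omega
  · have := hD u
    omega

/-- Few pebbles rarely share a vertex, and then no pebbling step is possible. -/
theorem solvableProb_le_sq_div {t : ℕ} (ht : t < Fintype.card V) :
    solvableProb G t ≤ (t : ℝ) ^ 2 / Fintype.card V := by
  classical
  have : Nonempty V := Fintype.card_pos_iff.1 (by omega)
  set n := Fintype.card V with hn
  have hn0 : (0 : ℝ) < n := by exact_mod_cast Fintype.card_pos (α := V)
  rcases lt_or_ge t 2 with h2 | h2
  · rw [solvableProb_eq_zero]
    · positivity
    · intro D hD
      refine not_solvable_of_le_one (fun v => ?_) (by omega)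
      have : D v ≤ size D := Finset.single_le_sum (fun _ _ => Nat.zero_le _) (Finset.mem_univ v)
      omega
  obtain ⟨s, rfl⟩ := Nat.exists_eq_add_of_le' h2
  rw [solvableProb_eq, div_le_div_iff₀ (card_dists_pos _) hn0, card_dists]
  have hsub : (dists V (s + 2)).filter (Solvable G) ⊆
      Finset.univ.biUnion fun v => (dists V (s + 2)).filter fun D => 2 ≤ D v := by
    intro D hD
    rw [Finset.mem_filter] at hD
    obtain ⟨v, hv⟩ : ∃ v, 2 ≤ D v := by
      by_contra! hlt
      exact not_solvable_of_le_one (fun v => Nat.le_of_lt_succ (hlt v))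
        (by rw [mem_dists.1 hD.1]; exact ht) hD.2
    simp only [Finset.mem_biUnion, Finset.mem_filter]
    exact ⟨v, Finset.mem_univ v, hD.1, hv⟩
  have hcard : ((dists V (s + 2)).filter (Solvable G)).card ≤ n * Nat.multichoose n s := by
    refine (Finset.card_le_card hsub).trans (Finset.card_biUnion_le.trans ?_)
    simp only [card_filter_two_le, Finset.sum_const, Finset.card_univ, smul_eq_mul]
    exact le_rfl
  have hrec := multichoose_add_two n s
  have : ((dists V (s + 2)).filter (Solvable G)).card * n ≤
      (s + 2) ^ 2 * Nat.multichoose n (s + 2) := by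
    calc _ ≤ n * Nat.multichoose n s * n := Nat.mul_le_mul_right _ hcard
      _ = n * n * Nat.multichoose n s := by ring
      _ ≤ (n + s + 1) * (n + s) * Nat.multichoose n s :=
          Nat.mul_le_mul_right _ (Nat.mul_le_mul (by omega) (by omega))
      _ = Nat.multichoose n (s + 2) * ((s + 2) * (s + 1)) := hrec.symm
      _ ≤ Nat.multichoose n (s + 2) * ((s + 2) * (s + 2)) :=
          Nat.mul_le_mul_left _ (Nat.mul_le_mul_left _ (by omega))
      _ = (s + 2) ^ 2 * Nat.multichoose n (s + 2) := by ring
  exact_mod_cast this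

/-- A root fails only if each of `d + 1` vertices within distance `d` of it holds fewer than `2 ^ d`
pebbles; this bounds the failure probability by a sum over the roots. -/
theorem solvableProb_ge_of_connected (hG : G.Connected) {d : ℕ} (hd : d + 1 < Fintype.card V)
    {t : ℕ} (ht : 0 < t) :
    1 - (2 ^ d) ^ (d + 1) * (Fintype.card V : ℝ) ^ (d + 2) / (t : ℝ) ^ (d + 1)
      ≤ solvableProb G t := by
  classical
  have := hG.nonempty
  refine solvableProb_ge ?_
  choose A hA hw using fun r => exists_finset_walk_length_le hG r (d := d) (by omega)
  set n := Fintype.card V with hn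
  have hsub : ((dists V t).filter fun D => ¬ Solvable G D) ⊆
      Finset.univ.biUnion fun r => (dists V t).filter fun D => ∀ v ∈ A r, D v < 2 ^ d := by
    intro D hD
    rw [Finset.mem_filter] at hD
    obtain ⟨hD, hns⟩ := hD
    rw [Solvable, not_forall] at hns
    obtain ⟨r, hr⟩ := hns
    simp only [Finset.mem_biUnion, Finset.mem_filter]
    refine ⟨r, Finset.mem_univ r, hD, fun v hv => ?_⟩
    by_contra! hle
    obtain ⟨p, hp⟩ := hw r v hv
    exact hr (Reaches.of_walk p
      (reaches_self ((Nat.pow_le_pow_right two_pos hp).trans hle)))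
  have hcard : ((dists V t).filter fun D => ¬ Solvable G D).card ≤
      n * (Nat.multichoose (n - (d + 1)) t * (2 ^ d) ^ (d + 1)) := by
    refine (Finset.card_le_card hsub).trans (Finset.card_biUnion_le.trans ?_)
    calc _ ≤ ∑ _r : V, Nat.multichoose (n - (d + 1)) t * (2 ^ d) ^ (d + 1) := by
          refine Finset.sum_le_sum fun r _ => ?_
          have := card_filter_lt_le (A := A r) (by rw [hA]; exact hd) (2 ^ d) t
          rwa [hA] at this
      _ = _ := by simp [hn]
  have hM := multichoose_mul_pow_le (n - (d + 1)) (d + 1) t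
  rw [Nat.sub_add_cancel (by omega)] at hM
  rw [div_mul_eq_mul_div, le_div_iff₀ (by positivity), card_dists]
  have : ((dists V t).filter fun D => ¬ Solvable G D).card * t ^ (d + 1) ≤
      (2 ^ d) ^ (d + 1) * n ^ (d + 2) * Nat.multichoose n t := by
    calc _ ≤ n * (Nat.multichoose (n - (d + 1)) t * (2 ^ d) ^ (d + 1)) * t ^ (d + 1) :=
          Nat.mul_le_mul_right _ hcard
      _ = n * (2 ^ d) ^ (d + 1) * (Nat.multichoose (n - (d + 1)) t * t ^ (d + 1)) := by ring
      _ ≤ n * (2 ^ d) ^ (d + 1) * (n ^ (d + 1) * Nat.multichoose n t) := Nat.mul_le_mul_left _ hM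
      _ = _ := by ring
  exact_mod_cast this

open Classical in
/-- The number of vertices holding at least two pebbles. -/
noncomputable def numRich (D : V → ℕ) : ℕ := (Finset.univ.filter fun v => 2 ≤ D v).card

theorem sum_numRich (s : ℕ) :
    ∑ D ∈ dists V (s + 2), numRich D = Fintype.card V * Nat.multichoose (Fintype.card V) s := by
  classical
  simp only [numRich, Finset.card_filter]
  rw [Finset.sum_comm]
  simp only [← Finset.card_filter, card_filter_two_le, Finset.sum_const, Finset.card_univ,
    smul_eq_mul]

theorem sum_numRich_sq_le (s : ℕ) :
    ∑ D ∈ dists V (s + 4), numRich D ^ 2 ≤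
      Fintype.card V * Nat.multichoose (Fintype.card V) (s + 2) +
        Fintype.card V ^ 2 * Nat.multichoose (Fintype.card V) s := by
  classical
  set n := Fintype.card V with hn
  have hsq : ∀ D : V → ℕ, numRich D ^ 2 = numRich D +
      ∑ p ∈ (Finset.univ : Finset V).offDiag, if 2 ≤ D p.1 ∧ 2 ≤ D p.2 then 1 else 0 := by
    intro D
    have h1 := Finset.offDiag_card (Finset.univ.filter fun v => 2 ≤ D v)
    have h2 : (Finset.univ.filter fun v => 2 ≤ D v).offDiag =
        (Finset.univ : Finset V).offDiag.filter fun p => 2 ≤ D p.1 ∧ 2 ≤ D p.2 := by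
      ext p
      simp only [Finset.mem_offDiag, Finset.mem_filter, Finset.mem_univ, true_and]
      tauto
    rw [← Finset.card_filter, ← h2, h1, ← numRich, sq]
    have := Nat.le_mul_self (numRich D)
    omega
  calc ∑ D ∈ dists V (s + 4), numRich D ^ 2
      = ∑ D ∈ dists V (s + 4), numRich D + ∑ p ∈ (Finset.univ : Finset V).offDiag,
        ((dists V (s + 4)).filter fun D => 2 ≤ D p.1 ∧ 2 ≤ D p.2).card := by
        rw [Finset.sum_congr rfl fun D _ => hsq D, Finset.sum_add_distrib, Finset.sum_comm]
        simp only [Finset.card_filter]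
    _ = n * Nat.multichoose n (s + 2) + (n * n - n) * Nat.multichoose n s := by
        rw [sum_numRich (s + 2), Finset.sum_congr rfl fun p hp =>
          card_filter_two_le_two_le (Finset.mem_offDiag.1 hp).2.2 s, Finset.sum_const,
          Finset.offDiag_card, Finset.card_univ, smul_eq_mul]
    _ ≤ _ := by
        rw [sq]
        exact Nat.add_le_add_left (Nat.mul_le_mul_right _ (Nat.sub_le _ _)) _

/-- The second moment method. With `μ` the mean of `numRich`, the variance is at most `μ` by
log-concavity, and Chebyshev's inequality applies. -/
theorem card_numRich_le_one_mul_le [Nonempty V] {s : ℕ} {μ : ℝ}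
    (hμ : μ * (dists V (s + 4)).card =
      Fintype.card V * Nat.multichoose (Fintype.card V) (s + 2)) (h1 : 1 ≤ μ) :
    (((dists V (s + 4)).filter fun D => numRich D ≤ 1).card : ℝ) * (μ - 1) ^ 2 ≤
      μ * (dists V (s + 4)).card := by
  have hN := card_dists_pos (V := V) (s + 4)
  have hlc : (Nat.multichoose (Fintype.card V) s : ℝ) * (dists V (s + 4)).card ≤
      (Nat.multichoose (Fintype.card V) (s + 2) : ℝ) ^ 2 := by
    rw [card_dists]
    exact_mod_cast multichoose_mul_multichoose_le Fintype.card_pos s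
  have hX : ∑ D ∈ dists V (s + 4), (numRich D : ℝ) =
      Fintype.card V * Nat.multichoose (Fintype.card V) (s + 2) := by
    exact_mod_cast sum_numRich (V := V) (s + 2)
  have hX2 : ∑ D ∈ dists V (s + 4), (numRich D : ℝ) ^ 2 ≤
      Fintype.card V * Nat.multichoose (Fintype.card V) (s + 2) +
        (Fintype.card V : ℝ) ^ 2 * Nat.multichoose (Fintype.card V) s := by
    exact_mod_cast sum_numRich_sq_le (V := V) s
  generalize (Nat.multichoose (Fintype.card V) (s + 2) : ℝ) = b at *
  generalize (Nat.multichoose (Fintype.card V) s : ℝ) = a at *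
  set N : ℝ := ((dists V (s + 4)).card : ℝ) with hNdef
  set n : ℝ := (Fintype.card V : ℝ)
  have hvar : ∑ D ∈ dists V (s + 4), ((numRich D : ℝ) - μ) ^ 2 =
      ∑ D ∈ dists V (s + 4), (numRich D : ℝ) ^ 2 - 2 * μ * ∑ D ∈ dists V (s + 4), (numRich D : ℝ)
        + μ ^ 2 * N := by
    simp only [sub_sq, Finset.sum_add_distrib, Finset.sum_sub_distrib, Finset.sum_const,
      nsmul_eq_mul, Finset.mul_sum]
    rw [mul_comm (μ ^ 2) N]
    congr 2
    exact Finset.sum_congr rfl fun _ _ => by ring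
  have hna : n ^ 2 * a ≤ μ ^ 2 * N := by
    refine le_of_mul_le_mul_right ?_ hN
    calc n ^ 2 * a * N = n ^ 2 * (a * N) := by ring
      _ ≤ n ^ 2 * b ^ 2 := mul_le_mul_of_nonneg_left hlc (by positivity)
      _ = (n * b) ^ 2 := by ring
      _ = μ ^ 2 * N * N := by rw [← hμ]; ring
  calc (((dists V (s + 4)).filter fun D => numRich D ≤ 1).card : ℝ) * (μ - 1) ^ 2
      = ∑ D ∈ (dists V (s + 4)).filter fun D => numRich D ≤ 1, (μ - 1) ^ 2 := by
        rw [Finset.sum_const, nsmul_eq_mul]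
    _ ≤ ∑ D ∈ (dists V (s + 4)).filter fun D => numRich D ≤ 1, ((numRich D : ℝ) - μ) ^ 2 := by
        refine Finset.sum_le_sum fun D hD => ?_
        have : (numRich D : ℝ) ≤ 1 := by exact_mod_cast (Finset.mem_filter.1 hD).2
        nlinarith
    _ ≤ ∑ D ∈ dists V (s + 4), ((numRich D : ℝ) - μ) ^ 2 :=
        Finset.sum_le_sum_of_subset_of_nonneg (Finset.filter_subset _ _) fun _ _ _ => sq_nonneg _
    _ ≤ μ * N := by
        rw [hvar, hX, ← hμ]
        rw [← hμ] at hX2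
        nlinarith

/-- In a graph containing a spanning star, far more than `√n` pebbles almost surely put two
pebbles on each of two vertices. -/
theorem solvableProb_ge_of_star_le [DecidableEq V] {c : V} (hG : SimpleGraph.starGraph c ≤ G)
    {t : ℕ} {k : ℝ} (hk : 2 ≤ k) (ht : 3 * k * √(Fintype.card V : ℝ) ≤ t)
    (hn : 3 * k ≤ √(Fintype.card V : ℝ)) : 1 - 2 / k ^ 2 ≤ solvableProb G t := by
  classical
  have : Nonempty V := ⟨c⟩
  set n : ℝ := (Fintype.card V : ℝ) with hndef
  set q := √n with hq
  have hq6 : 6 ≤ q := by linarith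
  have hqn : q ^ 2 = n := Real.sq_sqrt (by positivity)
  have ht4 : (4 : ℝ) ≤ t := by nlinarith
  obtain ⟨s, rfl⟩ := Nat.exists_eq_add_of_le' (show 4 ≤ t by exact_mod_cast ht4)
  set T : ℝ := ((s + 4 : ℕ) : ℝ) with hT
  set μ : ℝ := n * Nat.multichoose (Fintype.card V) (s + 2) / (dists V (s + 4)).card with hμdef
  have hN := card_dists_pos (V := V) (s + 4)
  have hμ : μ * (dists V (s + 4)).card = n * Nat.multichoose (Fintype.card V) (s + 2) :=
    div_mul_cancel₀ _ hN.ne'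
  -- Both summands of `n + T` are at most `q * T / (3 * k)`.
  have hbound : 2 * k ^ 2 * (n + T) ^ 2 ≤ n * T ^ 2 := by
    have h1 : 3 * k * (n + T) ≤ 2 * (q * T) := by rw [← hqn]; nlinarith
    have h2 : (3 * k * (n + T)) ^ 2 ≤ (2 * (q * T)) ^ 2 := by
      apply pow_le_pow_left₀ _ h1
      positivity
    rw [mul_pow 2, mul_pow q, hqn] at h2
    have h3 : (0 : ℝ) ≤ k ^ 2 * (n + T) ^ 2 := by positivity
    nlinarith
  have hμk : k ^ 2 ≤ μ := by
    rw [hμdef, le_div_iff₀ hN, card_dists]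
    have hrec : (Nat.multichoose (Fintype.card V) (s + 4) : ℝ) * (T * (T - 1)) =
        (n + T - 1) * (n + T - 2) * Nat.multichoose (Fintype.card V) (s + 2) := by
      have := multichoose_add_two (Fintype.card V) (s + 2)
      have h' := congrArg (Nat.cast : ℕ → ℝ) this
      push_cast at h'
      rw [← hndef] at h'
      rw [hT]
      push_cast
      linear_combination h'
    set M : ℝ := (Nat.multichoose (Fintype.card V) (s + 4) : ℝ)
    set b : ℝ := (Nat.multichoose (Fintype.card V) (s + 2) : ℝ)
    have hM : 0 ≤ M := Nat.cast_nonneg _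
    have hb : 0 ≤ b := Nat.cast_nonneg _
    have hn0 : 0 ≤ n := Nat.cast_nonneg _
    have hTpos : 0 < T * (T - 1) := by nlinarith
    refine le_of_mul_le_mul_right ?_ hTpos
    calc k ^ 2 * M * (T * (T - 1)) = k ^ 2 * (M * (T * (T - 1))) := by ring
      _ = k ^ 2 * ((n + T - 1) * (n + T - 2)) * b := by rw [hrec]; ring
      _ ≤ k ^ 2 * (n + T) ^ 2 * b := by
          refine mul_le_mul_of_nonneg_right (mul_le_mul_of_nonneg_left ?_ (by positivity)) hb
          nlinarith
      _ ≤ n * (T * (T - 1)) * b := by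
          refine mul_le_mul_of_nonneg_right ?_ hb
          have : T ^ 2 ≤ 2 * (T * (T - 1)) := by nlinarith
          nlinarith [mul_le_mul_of_nonneg_left this hn0]
      _ = n * b * (T * (T - 1)) := by ring
  have hk4 : 4 ≤ k ^ 2 := by nlinarith
  have hcheb := card_numRich_le_one_mul_le hμ (by linarith)
  refine solvableProb_ge ?_
  have hsub : ((dists V (s + 4)).filter fun D => ¬ Solvable G D) ⊆
      (dists V (s + 4)).filter fun D => numRich D ≤ 1 := by
    refine Finset.monotone_filter_right _ fun D _ hD => ?_
    by_contra! hlt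
    obtain ⟨u, hu, v, hv, huv⟩ := Finset.one_lt_card.1 hlt
    exact hD (solvable_of_star_le hG huv (Finset.mem_filter.1 hu).2 (Finset.mem_filter.1 hv).2)
  have hle : (((dists V (s + 4)).filter fun D => ¬ Solvable G D).card : ℝ) ≤
      ((dists V (s + 4)).filter fun D => numRich D ≤ 1).card := by
    exact_mod_cast Finset.card_le_card hsub
  refine hle.trans ?_
  set Y : ℝ := (((dists V (s + 4)).filter fun D => numRich D ≤ 1).card : ℝ)
  set N : ℝ := ((dists V (s + 4)).card : ℝ)
  have hY : 0 ≤ Y := Nat.cast_nonneg _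
  rw [div_mul_eq_mul_div, le_div_iff₀ (by positivity)]
  -- Since `4 ≤ k ^ 2 ≤ μ`, the factor `(μ - 1) ^ 2` is at least `μ * k ^ 2 / 2`.
  have h5 : μ * k ^ 2 ≤ 2 * (μ - 1) ^ 2 := by nlinarith
  have hμ0 : 0 < μ := by linarith
  refine le_of_mul_le_mul_left ?_ hμ0
  nlinarith [mul_le_mul_of_nonneg_left h5 hY]

end Probability

/-! ### Comparison of a threshold with a given size -/

section Threshold

variable {V : ℕ → Type*} [∀ m, Fintype (V m)] {G : ∀ m, SimpleGraph (V m)} {g : ℕ → ℝ}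

/-- If `g` outgrew `s` along a subsequence, then the sizes that agree with `s` there and vanish
elsewhere would be of smaller order than `g`. -/
theorem isBigO_of_solvableProb_ge (hg : g ∈ th G) {s : ℕ → ℕ} {c : ℝ} (hc : 0 < c)
    (hs : ∀ᶠ m in atTop, c ≤ solvableProb (G m) (s m)) : g =O[atTop] fun m => (s m : ℝ) := by
  classical
  by_contra hO
  have hfreq : ∀ k : ℕ, ∃ᶠ m in atTop, (k : ℝ) * s m < g m ∧ c ≤ solvableProb (G m) (s m) := by
    intro k
    rw [isBigO_iff, not_exists] at hO
    have h1 := hO k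
    rw [not_eventually] at h1
    refine (h1.and_eventually (hg.1.and hs)).mono ?_
    rintro m ⟨h2, h3, h4⟩
    rw [Real.norm_of_nonneg h3.le, Real.norm_of_nonneg (Nat.cast_nonneg _), not_le] at h2
    exact ⟨h2, h4⟩
  obtain ⟨φ, hφ, hφ'⟩ := extraction_forall_of_frequently hfreq
  have ht : (fun m => ((if m ∈ Set.range φ then s m else 0 : ℕ) : ℝ)) =o[atTop] g := by
    rw [isLittleO_iff]
    intro ε hε
    obtain ⟨K, hK⟩ := exists_nat_gt (1 / ε)
    filter_upwards [hg.1, eventually_ge_atTop (φ K)] with m hm hmK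
    rw [Real.norm_of_nonneg (Nat.cast_nonneg _), Real.norm_of_nonneg hm.le]
    split_ifs with hr
    · obtain ⟨k, rfl⟩ := hr
      have hkK : (K : ℝ) ≤ k := by exact_mod_cast hφ.le_iff_le.1 hmK
      have h1 := (hφ' k).1
      have h2 : 1 ≤ ε * k := by
        rw [div_lt_iff₀ hε] at hK
        nlinarith
      have h3 : (0 : ℝ) ≤ s (φ k) := Nat.cast_nonneg _
      nlinarith
    · simpa using (mul_pos hε hm).le
  have h0 := (hg.2.2 _ ht).comp hφ.tendsto_atTop
  refine absurd (ge_of_tendsto' h0 fun k => ?_) (not_le.2 hc)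
  have : φ k ∈ Set.range φ := ⟨k, rfl⟩
  simpa only [Function.comp_apply, this, if_true] using (hφ' k).2

/-- If `s` outgrew `g` along a subsequence, then sizes that agree with `s` there and are huge
elsewhere would be of larger order than `g`. -/
theorem isBigO_of_solvableProb_le (hg : g ∈ th G) {s : ℕ → ℕ} {c : ℝ} (hc : c < 1)
    (hs : ∀ᶠ m in atTop, solvableProb (G m) (s m) ≤ c) : (fun m => (s m : ℝ)) =O[atTop] g := by
  classical
  by_contra hO
  have hfreq : ∀ k : ℕ, ∃ᶠ m in atTop, (k : ℝ) * g m < s m ∧ solvableProb (G m) (s m) ≤ c := by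
    intro k
    rw [isBigO_iff, not_exists] at hO
    have h1 := hO k
    rw [not_eventually] at h1
    refine (h1.and_eventually (hg.1.and hs)).mono ?_
    rintro m ⟨h2, h3, h4⟩
    rw [Real.norm_of_nonneg h3.le, Real.norm_of_nonneg (Nat.cast_nonneg _), not_le] at h2
    exact ⟨h2, h4⟩
  obtain ⟨φ, hφ, hφ'⟩ := extraction_forall_of_frequently hfreq
  have ht : g =o[atTop] fun m => ((if m ∈ Set.range φ then s m else ⌈(m : ℝ) * g m⌉₊ : ℕ) : ℝ) := by
    rw [isLittleO_iff]
    intro ε hε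
    obtain ⟨K, hK⟩ := exists_nat_gt (1 / ε)
    rw [div_lt_iff₀ hε] at hK
    have hlarge : ∀ k : ℕ, K ≤ k → ∀ x y : ℝ, 0 < x → k * x ≤ y → x ≤ ε * y := by
      intro k hk x y hx hxy
      have hkK : (K : ℝ) ≤ k := by exact_mod_cast hk
      have h2 : 1 ≤ k * ε := hK.le.trans (mul_le_mul_of_nonneg_right hkK hε.le)
      nlinarith [mul_le_mul_of_nonneg_left hxy hε.le]
    filter_upwards [hg.1, eventually_ge_atTop (φ K), eventually_ge_atTop K] with m hm hmK hmK'
    rw [Real.norm_of_nonneg (Nat.cast_nonneg _), Real.norm_of_nonneg hm.le]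
    split_ifs with hr
    · obtain ⟨k, rfl⟩ := hr
      exact hlarge k (hφ.le_iff_le.1 hmK) _ _ hm (hφ' k).1.le
    · exact hlarge m hmK' _ _ hm (Nat.le_ceil _)
  have h0 := (hg.2.1 _ ht).comp hφ.tendsto_atTop
  refine absurd (le_of_tendsto' h0 fun k => ?_) (not_le.2 hc)
  have : φ k ∈ Set.range φ := ⟨k, rfl⟩
  simpa only [Function.comp_apply, this, if_true] using (hφ' k).2

theorem tendsto_sqrt_natCast {n : ℕ → ℕ} (hn : Tendsto n atTop atTop) :
    Tendsto (fun m => √(n m : ℝ)) atTop atTop :=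
  Real.tendsto_sqrt_atTop.comp (tendsto_natCast_atTop_atTop.comp hn)

theorem sqrt_isBigO_of_mem_th (hn : Tendsto (fun m => Fintype.card (V m)) atTop atTop)
    (hg : g ∈ th G) : (fun m => √(Fintype.card (V m) : ℝ)) =O[atTop] g := by
  have hq := tendsto_sqrt_natCast hn
  have h1 : ∀ᶠ m in atTop,
      solvableProb (G m) ⌊√(Fintype.card (V m) : ℝ) / 2⌋₊ ≤ 1 / 4 := by
    filter_upwards [hq.eventually_ge_atTop 2] with m hm
    set n := Fintype.card (V m)
    have hsq : √(n : ℝ) ^ 2 = n := Real.sq_sqrt (by positivity)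
    have hfl := Nat.floor_le (show (0 : ℝ) ≤ √(n : ℝ) / 2 by positivity)
    have hlt : ⌊√(n : ℝ) / 2⌋₊ < n := by
      have : (⌊√(n : ℝ) / 2⌋₊ : ℝ) < n := by nlinarith
      exact_mod_cast this
    refine (solvableProb_le_sq_div hlt).trans ?_
    rw [div_le_iff₀ (by nlinarith)]
    have := pow_le_pow_left₀ (Nat.cast_nonneg _) hfl 2
    linarith
  refine IsBigO.trans ?_ (isBigO_of_solvableProb_le hg (by norm_num) h1)
  refine IsBigO.of_bound 4 ?_
  filter_upwards [hq.eventually_ge_atTop 4] with m hm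
  rw [Real.norm_of_nonneg (Real.sqrt_nonneg _), Real.norm_of_nonneg (Nat.cast_nonneg _)]
  have := Nat.lt_floor_add_one (√(Fintype.card (V m) : ℝ) / 2)
  linarith

theorem tendsto_solvableProb_zero {t : ℕ → ℕ}
    (hn : Tendsto (fun m => Fintype.card (V m)) atTop atTop)
    (ht : (fun m => (t m : ℝ)) =o[atTop] fun m => √(Fintype.card (V m) : ℝ)) :
    Tendsto (fun m => solvableProb (G m) (t m)) atTop (𝓝 0) := by
  have hq := tendsto_sqrt_natCast hn
  rw [isLittleO_iff] at ht
  refine Metric.tendsto_nhds.2 fun ε hε => ?_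
  obtain ⟨δ, hδ, hδ1, hδε⟩ : ∃ δ : ℝ, 0 < δ ∧ δ ≤ 1 ∧ δ < ε :=
    ⟨min 1 (ε / 2), by positivity, min_le_left _ _, (min_le_right _ _).trans_lt (by linarith)⟩
  filter_upwards [ht hδ, hq.eventually_ge_atTop 2] with m hm hm2
  rw [Real.norm_of_nonneg (Real.sqrt_nonneg _), Real.norm_of_nonneg (Nat.cast_nonneg _)] at hm
  set n := Fintype.card (V m)
  have hsq : √(n : ℝ) ^ 2 = n := Real.sq_sqrt (by positivity)
  have hlt : t m < n := by
    have : (t m : ℝ) < n := by nlinarith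
    exact_mod_cast this
  rw [Real.dist_0_eq_abs, abs_of_nonneg (solvableProb_nonneg _ _)]
  refine lt_of_le_of_lt ((solvableProb_le_sq_div hlt).trans ?_) hδε
  rw [div_le_iff₀ (by nlinarith)]
  have := pow_le_pow_left₀ (Nat.cast_nonneg _) hm 2
  rw [mul_pow, hsq] at this
  have hn0 : (0 : ℝ) ≤ n := Nat.cast_nonneg _
  nlinarith [mul_le_mul_of_nonneg_right hδ1 hδ.le]

theorem isLittleO_rpow_of_mem_th (hG : ∀ m ≥ 1, (G m).Connected)
    (hn : Tendsto (fun m => Fintype.card (V m)) atTop atTop) (hg : g ∈ th G) {ε : ℝ}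
    (hε : 0 < ε) : g =o[atTop] fun m => (Fintype.card (V m) : ℝ) ^ (1 + ε) := by
  have hnR : Tendsto (fun m => (Fintype.card (V m) : ℝ)) atTop atTop :=
    tendsto_natCast_atTop_atTop.comp hn
  -- With `t = n ^ (1 + ε / 2)` and `d` so large that `ε / 2 * (d + 1) ≥ 2`, the failure probability
  -- is of order `n ^ (d + 2) / t ^ (d + 1) ≤ 1 / n`.
  obtain ⟨d, hd⟩ := exists_nat_gt (4 / ε)
  rw [div_lt_iff₀ hε] at hd
  set C : ℝ := (2 ^ d) ^ (d + 1) with hC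
  have hCpos : 0 < C := by positivity
  have h1 : ∀ᶠ m in atTop,
      1 / 2 ≤ solvableProb (G m) ⌈(Fintype.card (V m) : ℝ) ^ (1 + ε / 2)⌉₊ := by
    filter_upwards [eventually_ge_atTop 1, hn.eventually_gt_atTop (d + 1),
      hnR.eventually_ge_atTop (2 * C), hnR.eventually_ge_atTop 1] with m hm1 hmd hmC hn1
    set n := Fintype.card (V m)
    set t := ⌈(n : ℝ) ^ (1 + ε / 2)⌉₊
    have hn0 : (0 : ℝ) < n := by linarith
    have ht : (n : ℝ) ^ (1 + ε / 2) ≤ t := Nat.le_ceil _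
    have htpos : (0 : ℝ) < t := lt_of_lt_of_le (by positivity) ht
    refine le_trans ?_ (solvableProb_ge_of_connected (hG m hm1) hmd (by exact_mod_cast htpos))
    have hpow : (n : ℝ) ^ (d + 3) ≤ (t : ℝ) ^ (d + 1) := by
      refine le_trans ?_ (pow_le_pow_left₀ (by positivity) ht (d + 1))
      rw [← Real.rpow_natCast, ← Real.rpow_natCast, ← Real.rpow_mul hn0.le]
      refine Real.rpow_le_rpow_of_exponent_le hn1 ?_
      push_cast
      nlinarith
    have : C * (n : ℝ) ^ (d + 2) / (t : ℝ) ^ (d + 1) ≤ 1 / 2 := by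
      rw [div_le_iff₀ (by positivity)]
      have hp : (0 : ℝ) < (n : ℝ) ^ (d + 2) := by positivity
      rw [pow_succ] at hpow
      nlinarith
    linarith
  have h2 := isBigO_of_solvableProb_ge hg (by norm_num) h1
  refine h2.trans_isLittleO ?_
  have h3 : (fun m => ((⌈(Fintype.card (V m) : ℝ) ^ (1 + ε / 2)⌉₊ : ℕ) : ℝ)) =O[atTop]
      fun m => (Fintype.card (V m) : ℝ) ^ (1 + ε / 2) := by
    refine IsBigO.of_bound 2 ?_
    filter_upwards [hnR.eventually_ge_atTop 1] with m hm
    have h1 : 1 ≤ (Fintype.card (V m) : ℝ) ^ (1 + ε / 2) :=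
      Real.one_le_rpow hm (by positivity)
    rw [Real.norm_of_nonneg (by positivity), Real.norm_of_nonneg (by positivity)]
    have := Nat.ceil_lt_add_one (zero_le_one.trans h1)
    linarith
  have h4 : (fun x : ℝ => x ^ (1 + ε / 2)) =o[atTop] fun x : ℝ => x ^ (1 + ε) := by
    refine isLittleO_iff.2 fun c hc => ?_
    filter_upwards [(tendsto_rpow_atTop (half_pos hε)).eventually_ge_atTop c⁻¹,
      eventually_gt_atTop 0] with x hx h0
    rw [show 1 + ε = 1 + ε / 2 + ε / 2 by ring, Real.rpow_add h0 (1 + ε / 2),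
      Real.norm_of_nonneg (by positivity), Real.norm_of_nonneg (by positivity)]
    have h5 : 1 ≤ c * x ^ (ε / 2) := by rwa [inv_le_iff_one_le_mul₀' hc] at hx
    have h6 : 0 < x ^ (1 + ε / 2) := by positivity
    nlinarith
  exact h3.trans_isLittleO (h4.comp_tendsto hnR)

theorem isBigO_card_of_forall_solvable (hG : ∀ᶠ m in atTop, (G m).Connected) (hg : g ∈ th G)
    {C : ℕ} (h : ∀ᶠ m in atTop, ∀ D : V m → ℕ, size D = C * Fintype.card (V m) →
      Solvable (G m) D) : g =O[atTop] fun m => (Fintype.card (V m) : ℝ) := by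
  have h1 := isBigO_of_solvableProb_ge hg (s := fun m => C * Fintype.card (V m)) one_pos (by
    filter_upwards [hG, h] with m hm hD
    have := hm.nonempty
    exact solvableProb_ge_one hD)
  refine h1.trans ?_
  simp only [Nat.cast_mul]
  exact isBigO_const_mul_self _ _ _

end Threshold

/-! ### Paths and cycles -/

section Cycles

theorem natCast_isBigO_of_le_cycleGraph {G : ∀ n, SimpleGraph (Fin n)}
    (hG : ∀ n, G n ≤ SimpleGraph.cycleGraph n) {g : ℕ → ℝ} (hg : g ∈ th G) :
    (fun n : ℕ => (n : ℝ)) =O[atTop] g := by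
  have h1 : ∀ᶠ n in atTop, solvableProb (G n) (n / 5) ≤ 0 := by
    filter_upwards [eventually_ge_atTop 1] with n hn
    refine (solvableProb_eq_zero fun D hD hs => ?_).le
    exact cycleGraph_not_solvable (by omega) (hs.mono_graph (hG n))
  refine IsBigO.trans ?_ (isBigO_of_solvableProb_le hg one_pos h1)
  refine IsBigO.of_bound 9 ?_
  filter_upwards [eventually_ge_atTop 5] with n hn
  rw [Real.norm_of_nonneg (Nat.cast_nonneg _), Real.norm_of_nonneg (Nat.cast_nonneg _)]
  exact_mod_cast (by omega : n ≤ 9 * (n / 5))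

end Cycles

/-! ### Stars and wheels -/

section Stars

theorem th_eq_of_starGraph_le {G : ∀ n, SimpleGraph (Fin n)}
    (hG : ∀ n : ℕ, SimpleGraph.starGraph (0 : Fin (n + 1)) ≤ G (n + 1)) :
    th G = {g | (∀ᶠ n in atTop, 0 < g n) ∧ g =Θ[atTop] (fun n : ℕ => √(n : ℝ))} := by
  have hcard : Tendsto (fun n => Fintype.card (Fin n)) atTop atTop := by
    simpa using! tendsto_id
  have hq : Tendsto (fun n : ℕ => √(n : ℝ)) atTop atTop := tendsto_sqrt_natCast tendsto_id
  have key : ∀ (n t : ℕ) (k : ℝ), 1 ≤ n → 2 ≤ k → 3 * k * √(n : ℝ) ≤ t → 3 * k ≤ √(n : ℝ) →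
      1 - 2 / k ^ 2 ≤ solvableProb (G n) t := by
    intro n t k hn hk ht hk'
    obtain ⟨n, rfl⟩ := Nat.exists_eq_add_of_le' hn
    exact solvableProb_ge_of_star_le (hG n) hk (by simpa using ht) (by simpa using hk')
  ext g
  constructor
  · intro hg
    refine ⟨hg.1, ?_, by simpa using sqrt_isBigO_of_mem_th hcard hg⟩
    have h1 : ∀ᶠ n : ℕ in atTop, 1 / 2 ≤ solvableProb (G n) ⌈6 * √(n : ℝ)⌉₊ := by
      filter_upwards [eventually_ge_atTop 1, hq.eventually_ge_atTop 6] with n hn hn6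
      have := key n ⌈6 * √(n : ℝ)⌉₊ 2 hn le_rfl
        (le_trans (by norm_num) (Nat.le_ceil _)) (by linarith)
      norm_num at this ⊢
      linarith
    refine (isBigO_of_solvableProb_ge hg (by norm_num) h1).trans (IsBigO.of_bound 7 ?_)
    filter_upwards [hq.eventually_ge_atTop 1] with n hn
    rw [Real.norm_of_nonneg (Real.sqrt_nonneg _), Real.norm_of_nonneg (Nat.cast_nonneg _)]
    have := Nat.ceil_lt_add_one (show (0 : ℝ) ≤ 6 * √(n : ℝ) by positivity)
    linarith
  · rintro ⟨hpos, hle, hge⟩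
    refine ⟨hpos, fun t ht => ?_, fun t ht => ?_⟩
    · have ht := hge.trans_isLittleO ht
      rw [isLittleO_iff] at ht
      refine Metric.tendsto_nhds.2 fun ε hε => ?_
      obtain ⟨k, hk2, hkε⟩ : ∃ k : ℝ, 2 ≤ k ∧ 2 / k ^ 2 < ε := by
        refine ⟨2 + 2 / ε, by simp; positivity, ?_⟩
        have h0 : (0 : ℝ) < 2 / ε := by positivity
        rw [div_lt_iff₀ (by positivity)]
        have : ε * (2 / ε) = 2 := mul_div_cancel₀ _ hε.ne'
        nlinarith [mul_pos hε h0]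
      have hk0 : 0 < 3 * k := by linarith
      filter_upwards [ht (inv_pos.2 hk0), eventually_ge_atTop 1,
        hq.eventually_ge_atTop (3 * k)] with n h1 h2 h3
      rw [Real.norm_of_nonneg (Real.sqrt_nonneg _), Real.norm_of_nonneg (Nat.cast_nonneg _),
        inv_mul_eq_div, le_div_iff₀ hk0, mul_comm] at h1
      have := key n (t n) k h2 hk2 h1 h3
      rw [Real.dist_eq, abs_lt]
      constructor <;> linarith [solvableProb_le_one (G n) (t n)]
    · refine tendsto_solvableProb_zero hcard ?_
      simpa using ht.trans_isBigO hle

end Stars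

end Pebbling

open Pebbling

theorem mainTheorem2 :
    -- (a) every graph sequence
    (∀ (V : ℕ → Type) [∀ m, Fintype (V m)] (G : ∀ m, SimpleGraph (V m)),
      (∀ m ≥ 1, (G m).Connected) →
      Tendsto (fun m => Fintype.card (V m)) atTop atTop →
      ∀ g ∈ Pebbling.th G,
        (fun m => √(Fintype.card (V m) : ℝ)) =O[atTop] g ∧
        ∀ ε : ℝ, 0 < ε → g =o[atTop] (fun m => (Fintype.card (V m) : ℝ) ^ (1 + ε))) ∧
    -- (b) bounded diameter
    (∀ (V : ℕ → Type) [∀ m, Fintype (V m)] (G : ∀ m, SimpleGraph (V m)),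
      (∀ m ≥ 1, (G m).Connected) →
      Tendsto (fun m => Fintype.card (V m)) atTop atTop →
      ∀ d : ℕ, (∀ m ≥ 1, (G m).diam ≤ d) →
      ∀ g ∈ Pebbling.th G, g =O[atTop] (fun m => (Fintype.card (V m) : ℝ))) ∧
    -- (c) connectivity large in terms of the diameter
    (∀ (V : ℕ → Type) [∀ m, Fintype (V m)] (G : ∀ m, SimpleGraph (V m)),
      (∀ m ≥ 1, (G m).Connected) →
      Tendsto (fun m => Fintype.card (V m)) atTop atTop →
      (∀ᶠ m in atTop, 2 ^ (2 * (G m).diam + 3) ≤ Pebbling.connectivity (G m)) →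
      ∀ g ∈ Pebbling.th G, g =O[atTop] (fun m => (Fintype.card (V m) : ℝ))) ∧
    -- (d) cubes, with `n = 2 ^ m` vertices
    (∀ g ∈ Pebbling.th Pebbling.cube,
      (fun m : ℕ => √((2 : ℝ) ^ m)) =O[atTop] g ∧ g =O[atTop] (fun m : ℕ => (2 : ℝ) ^ m)) ∧
    -- (e) cycles
    (∀ g ∈ Pebbling.th SimpleGraph.cycleGraph,
      (fun n : ℕ => (n : ℝ)) =O[atTop] g ∧
      ∀ ε : ℝ, 0 < ε → g =o[atTop] (fun n : ℕ => (n : ℝ) ^ (1 + ε))) ∧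
    -- (f) paths
    (∀ g ∈ Pebbling.th SimpleGraph.pathGraph,
      (fun n : ℕ => (n : ℝ)) =O[atTop] g ∧
      ∀ ε : ℝ, 0 < ε → g =o[atTop] (fun n : ℕ => (n : ℝ) ^ (1 + ε))) ∧
    -- (g) stars
    (Pebbling.th Pebbling.starG =
      {g | (∀ᶠ n in atTop, 0 < g n) ∧ g =Θ[atTop] (fun n : ℕ => √(n : ℝ))}) ∧
    -- (h) wheels
    (Pebbling.th Pebbling.wheelG =
      {g | (∀ᶠ n in atTop, 0 < g n) ∧ g =Θ[atTop] (fun n : ℕ => √(n : ℝ))}) := by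
  have hfin : Tendsto (fun n => Fintype.card (Fin n)) atTop atTop := by
    simpa using! tendsto_id
  refine ⟨?_, ?_, ?_, ?_, ?_, ?_, ?_, ?_⟩
  · intro V _ G hG hn g hg
    exact ⟨sqrt_isBigO_of_mem_th hn hg, fun ε hε => isLittleO_rpow_of_mem_th hG hn hg hε⟩
  · intro V _ G hG _ d hd g hg
    refine isBigO_card_of_forall_solvable (eventually_atTop.2 ⟨1, hG⟩) hg (C := 2 ^ d) ?_
    filter_upwards [eventually_ge_atTop 1] with m hm D hD
    refine solvable_of_two_pow_diam_mul_card_le (hG m hm) ?_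
    rw [hD]
    exact Nat.mul_le_mul_right _ (Nat.pow_le_pow_right two_pos (hd m hm))
  · intro V _ G hG _ hk g hg
    refine isBigO_card_of_forall_solvable (eventually_atTop.2 ⟨1, hG⟩) hg (C := 3) ?_
    filter_upwards [eventually_ge_atTop 1, hk] with m hm hkm D hD
    exact solvable_of_connectivity (hG m hm)
      ((Nat.pow_le_pow_right two_pos (by omega)).trans hkm) hD.ge
  · intro g hg
    have hcard : ∀ m : ℕ, (Fintype.card (Fin m → Bool) : ℝ) = 2 ^ m := fun m => by simp
    have hn : Tendsto (fun m : ℕ => Fintype.card (Fin m → Bool)) atTop atTop := by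
      simpa using tendsto_pow_atTop_atTop_of_one_lt (r := 2) (by norm_num : 1 < 2)
    constructor
    · have := sqrt_isBigO_of_mem_th hn hg
      simpa only [hcard] using this
    · refine (isBigO_of_solvableProb_ge hg (s := fun m => 2 ^ m) one_pos
        (Eventually.of_forall fun m =>
          solvableProb_ge_one fun D hD => cube_solvable hD.ge)).congr_right fun m => by simp
  · intro g hg
    refine ⟨natCast_isBigO_of_le_cycleGraph (fun n => le_rfl) hg, fun ε hε => ?_⟩
    have := isLittleO_rpow_of_mem_th (fun m hm => ?_) hfin hg hε
    · simpa using this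
    · obtain ⟨n, rfl⟩ := Nat.exists_eq_add_of_le' hm
      exact SimpleGraph.cycleGraph_connected
  · intro g hg
    refine ⟨natCast_isBigO_of_le_cycleGraph
      (fun n => SimpleGraph.pathGraph_le_cycleGraph) hg, fun ε hε => ?_⟩
    have := isLittleO_rpow_of_mem_th (fun m hm => ?_) hfin hg hε
    · simpa using this
    · obtain ⟨n, rfl⟩ := Nat.exists_eq_add_of_le' hm
      exact SimpleGraph.pathGraph_connected n
  · exact th_eq_of_starGraph_le fun n => le_rfl
  · exact th_eq_of_starGraph_le fun n => le_sup_left
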